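/- **Setting.** Write $\mathcal D=\mathcal D(\mathbb R^d)$ for the space of smooth compactly supported (real- or complex-valued) functions on $\mathbb R^d$ with its canonical (LF)-topology, and $\mathcal D'$ for its dual. For $f\in\mathcal D'$, $\varphi\in\mathcal D$ put $(f*\varphi)(x)=\langle f,\varphi(x-\cdot)\rangle$, and $\varphi_j(x)=2^{jd}\varphi(2^jx)$ for $j\in\mathbb N=\{0,1,2,\dots\}$. For compact $K$ and $L\in\mathbb N$, $\mathcal D(K)$ is the set of $\varphi\in\mathcal D$ with support in $K$, and $\mathcal D_L(K)$ the set of $\varphi\in\mathcal D(K)$ with $\int x^\alpha\varphi(x)\,dx=0$ for all $|\alpha|<L$. A *solid translation-invariant Banach function space (TIBF) of bounded type* is a non-trivial Banach space $E$ continuously included in $L^1_{\rm loc}(\mathbb R^d)$ such that, with $T_xf=f(\cdot-x)$: $T_xE\subseteq E$ for all $x\in\mathbb R^d$; there is $C_0>0$ with $\|T_xf\|_E\le C_0\|f\|_E$ for all $x$ and all $f\in E$; $E*C_{\rm c}(\mathbb R^d)\subseteq E$; and whenever $f\in E$, $g\in L^1_{\rm loc}(\mathbb R^d)$ and $|g|\le|f|$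 almost everywhere, then $g\in E$ and $\|g\|_E\le\|f\|_E$. A *weight function system* is a sequence $\mathcal W=(w_n)_{n\in\mathbb N}$ of measurable, locally bounded functions $w_n:\mathbb R^d\to[1,\infty)$ with $w_n\le w_{n+1}$. It satisfies (wM) if for every $n$ there are $m\ge n$ and $C>0$ such that $w_n(x+y)\le Cw_m(x)$ for all $x\in\mathbb R^d$, $|y|\le1$. Put $E_{\mathcal W}=\{g\in L^1_{\rm loc}(\mathbb R^d): g\,w_n\in E\text{ for all }n\}$ and $$\mathcal O_C'(\mathcal D,E_{\mathcal W})=\{f\in\mathcal D': f*\varphi\in E_{\mathcal W}\text{ for all }\varphi\in\mathcal D\}.$$ A pair $(\chi^0,\chi^1)\in\mathcal D\times\mathcal D$ has the *moment-wise decomposition factorization property* (MDFP) if there is a compact $K\subset\mathbb R^d$ with non-empty interior such that for every $L\in\mathbb N$ there are non-trivial pairs $(\varphi^\ell_L,\psi^\ell_L)\in\mathcal D(K)\times\mathcal D_L(K)$, $\ell\in\{0,1\}$, with $$2^d\varphi^0_L(2\,\cdot)-\varphi^0_L=\Delta\psi^0_L,\qquad \int\varphi^0_L=1,$$ $$\varphi^0_L=\chi^0*\varphi^0_L+\chi^1*\varphi^1_L,\qquad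 \psi^0_L=\chi^0*\psi^0_L+\chi^1*\psi^1_L.$$ **Theorem.** Let $E$ be a solid TIBF of bounded type on $\mathbb R^d$, let $\mathcal W=(w_n)_{n\in\mathbb N}$ be a weight function system satisfying (wM), and suppose $(\chi^0,\chi^1)\in\mathcal D\times\mathcal D$ has the MDFP. Then for every $f\in\mathcal D'$ the following are equivalent: (i) $f\in\mathcal O_C'(\mathcal D,E_{\mathcal W})$; (ii) for every $\varphi\in\mathcal D$ and every $n\in\mathbb N$ there is a real $r>0$ such that $\{2^{-rj}(f*\varphi_j)\,w_n: j\in\mathbb N\}$ is contained in $E$ and bounded there; (iii) for every $n\in\mathbb N$ there is a real $r>0$ such that $\{2^{-rj}(f*\chi^\ell_j)\,w_n: j\in\mathbb N,\ \ell\in\{0,1\}\}$ is contained in $E$ and bounded there, where $\chi^\ell_j=(\chi^\ell)_j$. -/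

import Mathlib

open MeasureTheory

/-- Euclidean space `ℝ^d`. -/
abbrev Rd (d : ℕ) : Type := EuclideanSpace ℝ (Fin d)

/-- The test space `𝓓 = 𝓓(ℝ^d)`: smooth compactly supported `𝕜`-valued functions with the
canonical LF topology (here `𝕜` is `ℝ` or `ℂ`). -/
abbrev TestFn (d : ℕ) (𝕜 : Type*) [RCLike 𝕜] : Type _ :=
  TestFunction (⊤ : TopologicalSpace.Opens (Rd d)) 𝕜 ⊤

/-- Distributions on `ℝ^d`: continuous linear functionals on the test space. -/
abbrev Distr (d : ℕ) (𝕜 : Type*) [RCLike 𝕜] : Type _ :=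
  TestFn d 𝕜 →L[𝕜] 𝕜

namespace TestFn

variable {d : ℕ} {𝕜 : Type*} [RCLike 𝕜]

/-- The test function `t ↦ φ (x - t)`. -/
noncomputable def reflectAt (φ : TestFn d 𝕜) (x : Rd d) : TestFn d 𝕜 where
  toFun t := φ (x - t)
  contDiff' := φ.contDiff.comp (contDiff_const.sub contDiff_id)
  hasCompactSupport' := φ.hasCompactSupport.comp_homeomorph (Homeomorph.subLeft x)
  tsupport_subset' := fun _ _ => trivial

/-- The dilated window `φ_j = 2 ^ (j d) φ (2 ^ j ·)`. -/
noncomputable def dilate (φ : TestFn d 𝕜) (j : ℕ) : TestFn d 𝕜 where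
  toFun t := ((2 : ℝ) ^ (j * d)) • φ ((2 : ℝ) ^ j • t)
  contDiff' := (φ.contDiff.comp (contDiff_id.const_smul ((2 : ℝ) ^ j))).const_smul _
  hasCompactSupport' :=
    (φ.hasCompactSupport.comp_homeomorph
      (Homeomorph.smulOfNeZero ((2 : ℝ) ^ j) (by positivity))).smul_left
        (f := fun _ => (2 : ℝ) ^ (j * d))
  tsupport_subset' := fun _ _ => trivial

end TestFn

/-- Convolution of a distribution with a test function, `(f * φ)(x) = ⟨f, φ(x - ·)⟩`. -/
noncomputable def Distr.conv {d : ℕ} {𝕜 : Type*} [RCLike 𝕜] (f : Distr d 𝕜) (φ : TestFn d 𝕜) :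
    Rd d → 𝕜 :=
  fun x => f (φ.reflectAt x)

/-- Convolution of two functions, `(g * h)(x) = ∫ g(t) h(x - t) dt`. -/
noncomputable def fnConv {d : ℕ} {𝕜 : Type*} [RCLike 𝕜] (g h : Rd d → 𝕜) : Rd d → 𝕜 :=
  convolution g h (ContinuousLinearMap.mul 𝕜 𝕜) volume

section BanachFunctionSpace

variable {d : ℕ} {𝕜 : Type*} [RCLike 𝕜] {E : Type*} [NormedAddCommGroup E] [NormedSpace 𝕜 E]

/-- `E` is a solid translation-invariant Banach function space of bounded type on `ℝ^d`.
A Banach space of (classes of) functions is given as a Banach space `E` together with the linear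
inclusion `ι` into the space of a.e. classes of measurable functions. -/
structure IsSolidTIBF [CompleteSpace E] (ι : E →ₗ[𝕜] (Rd d →ₘ[volume] 𝕜)) : Prop where
  injective : Function.Injective ι
  nontrivial : Nontrivial E
  locallyIntegrable : ∀ f : E, LocallyIntegrable (ι f) volume
  /-- The inclusion into `L¹_loc` is continuous. -/
  continuous_incl : ∀ K : Set (Rd d), IsCompact K →
    ∃ C : ℝ, ∀ f : E, ∫ x in K, ‖ι f x‖ ≤ C * ‖f‖
  /-- `T_x E ⊆ E` and `‖T_x f‖ ≤ C₀ ‖f‖`. -/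
  translation : ∃ C₀ : ℝ, 0 < C₀ ∧ ∀ (x : Rd d) (f : E),
    ∃ g : E, (ι g =ᵐ[volume] fun t => ι f (t - x)) ∧ ‖g‖ ≤ C₀ * ‖f‖
  /-- `E * C_c ⊆ E`. -/
  convolution_mem : ∀ (f : E) (φ : Rd d → 𝕜), Continuous φ → HasCompactSupport φ →
    ∃ g : E, ι g =ᵐ[volume] fnConv (ι f) φ
  solid : ∀ (f : E) (g : Rd d → 𝕜), LocallyIntegrable g volume →
    (∀ᵐ x ∂(volume : Measure (Rd d)), ‖g x‖ ≤ ‖ι f x‖) →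
    ∃ h : E, ι h =ᵐ[volume] g ∧ ‖h‖ ≤ ‖f‖

/-- The set `S` of functions is contained in `E` and bounded there. -/
def IsBoundedSetIn (ι : E →ₗ[𝕜] (Rd d →ₘ[volume] 𝕜)) (S : Set (Rd d → 𝕜)) : Prop :=
  ∃ C : ℝ, ∀ g ∈ S, ∃ e : E, ι e =ᵐ[volume] g ∧ ‖e‖ ≤ C

/-- The weighted space `E_η = {g ∈ L¹_loc : g η ∈ E}`. -/
def weightedSpace (ι : E →ₗ[𝕜] (Rd d →ₘ[volume] 𝕜)) (η : Rd d → ℝ) : Set (Rd d → 𝕜) :=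
  {g | LocallyIntegrable g volume ∧ ∃ e : E, ι e =ᵐ[volume] fun x => η x • g x}

/-- The space `E_𝒲 = ⋂ₙ E_{wₙ}`. -/
def weightedSystemSpace (ι : E →ₗ[𝕜] (Rd d →ₘ[volume] 𝕜)) (w : ℕ → Rd d → ℝ) :
    Set (Rd d → 𝕜) :=
  ⋂ n, weightedSpace ι (w n)

/-- The convolutor space `O'_C(𝓓, E_𝒲) = {f ∈ 𝓓' : f * φ ∈ E_𝒲 for all φ ∈ 𝓓}`. -/
def convolutorSpace (ι : E →ₗ[𝕜] (Rd d →ₘ[volume] 𝕜)) (w : ℕ → Rd d → ℝ) : Set (Distr d 𝕜) :=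
  {f | ∀ φ : TestFn d 𝕜, f.conv φ ∈ weightedSystemSpace ι w}

end BanachFunctionSpace

/-- A weight function: measurable, locally bounded, with values in `[1, ∞)`. -/
structure IsWeightFunction {d : ℕ} (η : Rd d → ℝ) : Prop where
  measurable : Measurable η
  one_le : ∀ x, 1 ≤ η x
  locally_bounded : ∀ K : Set (Rd d), IsCompact K → ∃ C : ℝ, ∀ x ∈ K, η x ≤ C

/-- A weight function system: an increasing sequence of weight functions. -/
structure IsWeightSystem {d : ℕ} (w : ℕ → Rd d → ℝ) : Prop where
  weight : ∀ n, IsWeightFunction (w n)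
  mono : ∀ n x, w n x ≤ w (n + 1) x

/-- Condition `(wM)` (weak moderateness). -/
def WeakModerate {d : ℕ} (w : ℕ → Rd d → ℝ) : Prop :=
  ∀ n, ∃ m, n ≤ m ∧ ∃ C : ℝ, 0 < C ∧ ∀ x y : Rd d, ‖y‖ ≤ 1 → w n (x + y) ≤ C * w m x

/-- All moments of order `< L` vanish. -/
def VanishingMoments {d : ℕ} {𝕜 : Type*} [RCLike 𝕜] (L : ℕ) (φ : TestFn d 𝕜) : Prop :=
  ∀ α : Fin d → ℕ, ∑ i, α i < L → ∫ x : Rd d, (∏ i, x i ^ α i) • φ x = 0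

/-- The moment-wise decomposition factorization property of a pair of windows `χ 0, χ 1`. -/
def MDFP {d : ℕ} {𝕜 : Type*} [RCLike 𝕜] (χ : Fin 2 → TestFn d 𝕜) : Prop :=
  ∃ K : Set (Rd d), IsCompact K ∧ (interior K).Nonempty ∧
    ∀ L : ℕ, ∃ φ ψ : Fin 2 → TestFn d 𝕜,
      (∀ l, tsupport (φ l) ⊆ K ∧ tsupport (ψ l) ⊆ K ∧ VanishingMoments L (ψ l) ∧
        (φ l, ψ l) ≠ (0, 0)) ∧
      (∀ x : Rd d, ((2 : ℝ) ^ d) • φ 0 ((2 : ℝ) • x) - φ 0 x =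
        Laplacian.laplacian (ψ 0 : Rd d → 𝕜) x) ∧
      (∫ x : Rd d, φ 0 x = 1) ∧
      (∀ x : Rd d, φ 0 x = fnConv (χ 0) (φ 0) x + fnConv (χ 1) (φ 1) x) ∧
      (∀ x : Rd d, ψ 0 x = fnConv (χ 0) (ψ 0) x + fnConv (χ 1) (ψ 1) x)

/-! (i) ⇒ (ii) is a uniform boundedness argument. If no exponent worked, then for every `r` some
dilate would satisfy `2^(-(r+1)j) ‖(f * φ_j) w_n‖ > r`. An `i`-th derivative of `φ_j` costs only
`2^(j(d+i))`, so these rescaled dilates form a bounded sequence of test functions with supports in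
one ball. Summing them against `ℓ¹` coefficients and convolving with `f` gives a linear map `ℓ¹ →
E`. It is bounded by the closed graph theorem (`exists_bound_of_pointwise`), and evaluating it at
the unit vectors gives a contradiction.

(ii) ⇒ (iii) takes the larger of two exponents.

(iii) ⇒ (i) reconstructs `f * θ`. Since `∫ φ⁰ = 1`, the functions `f * θ * φ⁰_j` converge pointwise
to `f * θ`. By the refinement equation their successive differences are `4^(-j) f * Δθ * ψ⁰_j`, and
the factorization turns each into `4^(-j) ∑_l (f * χ^l_j) * (ψ^l_j * Δθ)`. The first factor grows at
most like `2^(rj)` in weighted norm. The second is `O(2^(-j(L+1)))` uniformly, by Taylor expansion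
and vanishing moments (`exists_bound_dilate_conv`). A weighted Young inequality
(`exists_weighted_bound`) combines the two. As `L` may be chosen after `r`, the telescoping series
converges absolutely in `E`, and `ae_eq_of_tendsto` identifies its sum with `(f * θ) w_n`. -/

open scoped BoundedContinuousFunction Pointwise ENNReal

/-! ### Jets of test functions and the local order of distributions -/

/-- The Banach space of bounded continuous functions with values in the `i`-linear forms. -/
abbrev DerivSpace (d : ℕ) (𝕜 : Type*) [RCLike 𝕜] (i : ℕ) : Type _ :=
  Rd d →ᵇ (Rd d [×i]→L[ℝ] 𝕜)

/-- The Banach space of jets of order `N`. -/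
def JetSpace (d : ℕ) (𝕜 : Type*) [RCLike 𝕜] (N : ℕ) : Type _ :=
  (i : Fin (N + 1)) → DerivSpace d 𝕜 i

namespace JetSpace

variable {d : ℕ} {𝕜 : Type*} [RCLike 𝕜] {N : ℕ}

noncomputable instance : NormedAddCommGroup (JetSpace d 𝕜 N) :=
  inferInstanceAs (NormedAddCommGroup ((i : Fin (N + 1)) → DerivSpace d 𝕜 i))

set_option synthInstance.maxHeartbeats 200000 in
noncomputable instance : NormedSpace 𝕜 (JetSpace d 𝕜 N) :=
  inferInstanceAs (NormedSpace 𝕜 ((i : Fin (N + 1)) → DerivSpace d 𝕜 i))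

noncomputable instance : NormedSpace ℝ (JetSpace d 𝕜 N) :=
  inferInstanceAs (NormedSpace ℝ ((i : Fin (N + 1)) → DerivSpace d 𝕜 i))

instance : CompleteSpace (JetSpace d 𝕜 N) :=
  inferInstanceAs (CompleteSpace ((i : Fin (N + 1)) → DerivSpace d 𝕜 i))

end JetSpace

namespace TestFn

variable {d : ℕ} {𝕜 : Type*} [RCLike 𝕜]

theorem contDiff_top (φ : TestFn d 𝕜) {n : ℕ} : ContDiff ℝ n φ :=
  φ.contDiff.of_le (mod_cast le_top)

theorem continuous_iteratedFDeriv (φ : TestFn d 𝕜) (i : ℕ) :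
    Continuous (iteratedFDeriv ℝ i φ) :=
  φ.contDiff.continuous_iteratedFDeriv (mod_cast le_top)

theorem exists_bound_iteratedFDeriv (φ : TestFn d 𝕜) (i : ℕ) :
    ∃ C, ∀ x, ‖iteratedFDeriv ℝ i φ x‖ ≤ C :=
  (φ.continuous_iteratedFDeriv i).bounded_above_of_compact_support
    (φ.hasCompactSupport.iteratedFDeriv i)

/-- The `i`-th derivative of a test function as a bounded continuous function. -/
noncomputable def derivBCF (i : ℕ) (φ : TestFn d 𝕜) : Rd d →ᵇ (Rd d [×i]→L[ℝ] 𝕜) :=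
  BoundedContinuousFunction.ofNormedAddCommGroup (iteratedFDeriv ℝ i φ)
    (φ.continuous_iteratedFDeriv i) (φ.exists_bound_iteratedFDeriv i).choose
    (φ.exists_bound_iteratedFDeriv i).choose_spec

@[simp] theorem derivBCF_apply (i : ℕ) (φ : TestFn d 𝕜) (x : Rd d) :
    derivBCF i φ x = iteratedFDeriv ℝ i φ x := rfl

/-- The jet of order `N` of a test function, in a Banach space. -/
noncomputable def jet (N : ℕ) :
    TestFn d 𝕜 →ₗ[𝕜] JetSpace d 𝕜 N where
  toFun φ i := derivBCF i φ
  map_add' φ ψ := by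
    funext i; ext1 x
    exact iteratedFDeriv_add_apply φ.contDiff_top.contDiffAt ψ.contDiff_top.contDiffAt
  map_smul' c φ := by
    funext i; ext1 x
    exact iteratedFDeriv_const_smul_apply φ.contDiff_top.contDiffAt

@[simp] theorem jet_apply (N : ℕ) (φ : TestFn d 𝕜) (i : Fin (N + 1)) (x : Rd d) :
    jet N φ i x = iteratedFDeriv ℝ i φ x := rfl

theorem jet_injective (N : ℕ) : Function.Injective (jet (d := d) (𝕜 := 𝕜) N) := by
  intro φ ψ h
  ext x
  have h0 : iteratedFDeriv ℝ 0 φ x = iteratedFDeriv ℝ 0 ψ x :=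
    congrArg (fun G : JetSpace d 𝕜 N => G 0 x) h
  exact congrArg (fun G => G (fun _ => 0)) h0

/-- The test functions supported in a given set. -/
def supportedIn (K : Set (Rd d)) : Submodule 𝕜 (TestFn d 𝕜) where
  carrier := {φ | tsupport φ ⊆ K}
  add_mem' {φ ψ} hφ hψ := (tsupport_add φ ψ).trans (Set.union_subset hφ hψ)
  zero_mem' := by
    change tsupport (0 : Rd d → 𝕜) ⊆ K
    simp [tsupport]
  smul_mem' c φ hφ := (tsupport_smul_subset_right (fun _ => c) φ).trans hφ

end TestFn

namespace Distr

variable {d : ℕ} {𝕜 : Type*} [RCLike 𝕜]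

/-- A distribution has finite order on each compact set. -/
theorem exists_order (f : Distr d 𝕜) {K : Set (Rd d)} (hK : IsCompact K) :
    ∃ (N : ℕ) (C : ℝ), 0 ≤ C ∧ ∀ ψ : TestFn d 𝕜, tsupport ψ ⊆ K →
      ‖f ψ‖ ≤ C * ‖TestFn.jet (d := d) (𝕜 := 𝕜) N ψ‖ := by
  let K' : TopologicalSpace.Compacts (Rd d) := ⟨K, hK⟩
  let T := TestFunction.ofSupportedInCLM 𝕜 (F := 𝕜) (n := ⊤) (Ω := (⊤ : TopologicalSpace.Opens (Rd d)))
    (K := K') (fun _ _ => trivial)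
  have hT : Continuous T := T.continuous
  let q : Seminorm 𝕜 (ContDiffMapSupportedIn (Rd d) 𝕜 ⊤ K') :=
    (normSeminorm 𝕜 𝕜).comp (f.toLinearMap ∘ₗ T.toLinearMap)
  have hq : Continuous q := continuous_norm.comp (f.continuous.comp hT)
  -- Continuity on the functions supported in `K` involves finitely many derivative seminorms; the
  -- highest index among them, `s.sup id`, is the order.
  obtain ⟨s, C, -, hC⟩ := Seminorm.bound_of_continuous
    (ContDiffMapSupportedIn.withSeminorms 𝕜 (Rd d) 𝕜 ⊤ K') q hq
  refine ⟨s.sup id, C, C.2, fun ψ hψ => ?_⟩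
  let ψ' : ContDiffMapSupportedIn (Rd d) 𝕜 ⊤ K' :=
    ContDiffMapSupportedIn.of_support_subset ψ.contDiff ((subset_tsupport _).trans hψ)
  have h1 : ‖f ψ‖ = q ψ' := rfl
  rw [h1]
  refine (hC ψ').trans ?_
  rw [_root_.smul_apply]
  refine mul_le_mul_of_nonneg_left ?_ C.2
  refine Seminorm.finset_sup_apply_le (norm_nonneg _) fun i hi => ?_
  rw [ContDiffMapSupportedIn.seminorm_top_le_iff 𝕜 (norm_nonneg _)]
  intro x _
  have hi' : i < s.sup id + 1 := Nat.lt_succ_of_le (Finset.le_sup (f := id) hi)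
  exact (BoundedContinuousFunction.norm_coe_le_norm
    (TestFn.jet (s.sup id) ψ ⟨i, hi'⟩) x).trans
      (norm_le_pi_norm (show (i : Fin (s.sup id + 1)) → DerivSpace d 𝕜 i from TestFn.jet (s.sup id) ψ) ⟨i, hi'⟩)

/-- On test functions supported in a compact set, a distribution is a continuous linear functional
of the jet. -/
theorem exists_jet_extension (f : Distr d 𝕜) {K : Set (Rd d)} (hK : IsCompact K) :
    ∃ (N : ℕ) (F : StrongDual 𝕜 (JetSpace d 𝕜 N)),
      ∀ ψ : TestFn d 𝕜, tsupport ψ ⊆ K → F (TestFn.jet N ψ) = f ψ := by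
  obtain ⟨N, C, hC, hb⟩ := Distr.exists_order f hK
  let S : Submodule 𝕜 (TestFn d 𝕜) := TestFn.supportedIn K
  let J := (TestFn.jet (d := d) (𝕜 := 𝕜) N).domRestrict S
  have hJ : Function.Injective J := fun a b h => Subtype.ext (TestFn.jet_injective N h)
  let e := LinearEquiv.ofInjective J hJ
  let g : LinearMap.range J →ₗ[𝕜] 𝕜 := (f.toLinearMap.domRestrict S) ∘ₗ e.symm.toLinearMap
  have hg : ∀ x, ‖g x‖ ≤ C * ‖x‖ := by
    intro x
    obtain ⟨ψ, rfl⟩ := e.surjective x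
    have : g (e ψ) = f ψ := by simp [g]
    rw [this]
    exact hb ψ ψ.2
  -- Hahn–Banach extends the functional from the range of jets to the whole Banach space, so that
  -- `f` can later be interchanged with Bochner integrals.
  obtain ⟨F, hF, -⟩ := exists_extension_norm_eq (LinearMap.range J) (g.mkContinuous C hg)
  refine ⟨N, F, fun ψ hψ => ?_⟩
  have := hF (e ⟨ψ, hψ⟩)
  have h2 : g (e ⟨ψ, hψ⟩) = f ψ := by simp [g]
  rw [← h2]
  exact this

theorem exists_bound (f : Distr d 𝕜) {K : Set (Rd d)} (hK : IsCompact K) :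
    ∃ (N : ℕ) (C : ℝ), 0 ≤ C ∧ ∀ (ψ : TestFn d 𝕜) (M : ℝ), tsupport ψ ⊆ K →
      (∀ i ≤ N, ∀ x, ‖iteratedFDeriv ℝ i ψ x‖ ≤ M) → ‖f ψ‖ ≤ C * M := by
  obtain ⟨N, C, hC, hb⟩ := Distr.exists_order f hK
  refine ⟨N, C, hC, fun ψ M hψ h => (hb ψ hψ).trans (mul_le_mul_of_nonneg_left ?_ hC)⟩
  have hM : 0 ≤ M := (norm_nonneg _).trans (h 0 (Nat.zero_le _) 0)
  refine (pi_norm_le_iff_of_nonneg hM).2 fun i => ?_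
  exact (BoundedContinuousFunction.norm_le hM).2 fun x => h i (Nat.lt_succ_iff.1 i.2) x

end Distr

theorem isCompact_sub {G : Type*} [AddGroup G] [TopologicalSpace G] [IsTopologicalAddGroup G]
    {X K : Set G} (hX : IsCompact X) (hK : IsCompact K) : IsCompact (X - K) := by
  rw [sub_eq_add_neg]
  exact hX.add hK.neg

/-! ### Differentiation under the integral sign -/

section ParametricIntegral

variable {d : ℕ} {V : Type*} [NormedAddCommGroup V] [NormedSpace ℝ V]

theorem hasFDerivAt_integral_of_compact {G : Rd d → Rd d → V} {T : Set (Rd d)} (hT : IsCompact T)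
    (hG0 : ∀ t ∉ T, ∀ s, G t s = 0) (hGd : ∀ t, Differentiable ℝ (G t))
    (hGc : Continuous fun p : Rd d × Rd d => G p.1 p.2)
    (hG' : Continuous fun p : Rd d × Rd d => fderiv ℝ (G p.1) p.2) (s₀ : Rd d) :
    HasFDerivAt (fun s => ∫ t, G t s) (∫ t, fderiv ℝ (G t) s₀) s₀ := by
  obtain ⟨C, hC⟩ := (hT.prod (isCompact_closedBall s₀ 1)).exists_bound_of_continuousOn
    hG'.continuousOn
  have hsupp : ∀ s, HasCompactSupport fun t => G t s := fun s =>
    HasCompactSupport.intro hT fun t ht => hG0 t ht s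
  have hzero : ∀ t ∉ T, ∀ s, fderiv ℝ (G t) s = 0 := by
    intro t ht s
    have : G t = fun _ => 0 := funext (hG0 t ht)
    rw [this]; simp
  refine hasFDerivAt_integral_of_dominated_of_fderiv_le (F' := fun s t => fderiv ℝ (G t) s)
    (bound := T.indicator fun _ => C) (Metric.closedBall_mem_nhds s₀ one_pos) ?_ ?_ ?_ ?_ ?_ ?_
  · exact Filter.Eventually.of_forall fun s =>
      (hGc.comp (continuous_id.prodMk continuous_const)).aestronglyMeasurable
  · exact (hGc.comp (continuous_id.prodMk continuous_const)).integrable_of_hasCompactSupport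
      (hsupp s₀)
  · exact (hG'.comp (continuous_id.prodMk continuous_const)).aestronglyMeasurable
  · refine Filter.Eventually.of_forall fun t s hs => ?_
    by_cases ht : t ∈ T
    · rw [Set.indicator_of_mem ht]
      exact hC (t, s) ⟨ht, hs⟩
    · rw [Set.indicator_of_notMem ht, hzero t ht s, norm_zero]
  · exact (integrable_indicator_iff hT.measurableSet).2
      (integrableOn_const (by exact hT.measure_lt_top.ne))
  · exact Filter.Eventually.of_forall fun t s _ => (hGd t s).hasFDerivAt

/-- Induction on the order: the derivative of order `i + 1` is the curried derivative of the one of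
order `i`, and currying commutes with the integral. One compact `T` works for every `s`, which
supplies the dominating function. -/
theorem iteratedFDeriv_integral_of_compact [CompleteSpace V] {G : Rd d → Rd d → V} {T : Set (Rd d)}
    (hT : IsCompact T) (hG0 : ∀ t ∉ T, ∀ s, G t s = 0)
    (hGd : ∀ (i : ℕ) (t : Rd d), ContDiff ℝ i (G t))
    (hGc : ∀ i : ℕ, Continuous fun p : Rd d × Rd d => iteratedFDeriv ℝ i (G p.1) p.2) (i : ℕ) :
    ∀ s, iteratedFDeriv ℝ i (fun s => ∫ t, G t s) s = ∫ t, iteratedFDeriv ℝ i (G t) s := by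
  have hzero : ∀ i : ℕ, ∀ t ∉ T, ∀ s, iteratedFDeriv ℝ i (G t) s = 0 := by
    intro i t ht s
    have : G t = fun _ => 0 := funext (hG0 t ht)
    rw [this, iteratedFDeriv_fun_zero]; rfl
  induction i with
  | zero =>
    intro s
    simp only [iteratedFDeriv_zero_eq_comp, Function.comp_apply]
    exact ((continuousMultilinearCurryFin0 ℝ (Rd d)
      V).symm.toContinuousLinearEquiv.integral_comp_comm _).symm
  | succ i ih =>
    intro s
    have h1 : iteratedFDeriv ℝ i (fun s => ∫ t, G t s) =
        fun s => ∫ t, iteratedFDeriv ℝ i (G t) s := funext ih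
    have hd : ∀ t, Differentiable ℝ (iteratedFDeriv ℝ i (G t)) := fun t =>
      (hGd (i + 1) t).differentiable_iteratedFDeriv (mod_cast Nat.lt_succ_self i)
    have hc : Continuous fun p : Rd d × Rd d => fderiv ℝ (iteratedFDeriv ℝ i (G p.1)) p.2 := by
      have := (continuousMultilinearCurryLeftEquiv ℝ (fun _ : Fin (i + 1) => Rd d) V).continuous.comp
        (hGc (i + 1))
      refine this.congr fun p => ?_
      simp [iteratedFDeriv_succ_eq_comp_left]
    have h2 := hasFDerivAt_integral_of_compact hT (G := fun t => iteratedFDeriv ℝ i (G t))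
      (hzero i) hd (hGc i) hc s
    simp only [iteratedFDeriv_succ_eq_comp_left, Function.comp_apply]
    rw [h1, h2.fderiv]
    exact (ContinuousLinearEquiv.integral_comp_comm (X := Rd d) (μ := volume) (𝕜 := ℝ) (E := Rd d →L[ℝ] (Rd d [×i]→L[ℝ] V))
      (F := Rd d [×(i + 1)]→L[ℝ] V) (continuousMultilinearCurryLeftEquiv ℝ
        (fun _ : Fin (i + 1) => Rd d) V).symm.toContinuousLinearEquiv _).symm

end ParametricIntegral

/-! ### Convolution of functions, test functions and distributions -/

theorem iteratedFDeriv_comp_const_sub {d : ℕ} {V : Type*} [NormedAddCommGroup V] [NormedSpace ℝ V]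
    {h : Rd d → V} {i : ℕ} (hh : ContDiff ℝ i h) (t s : Rd d) :
    iteratedFDeriv ℝ i (fun s => h (t - s)) s = (-1 : ℝ) ^ i • iteratedFDeriv ℝ i h (t - s) := by
  have h1 : (fun s => h (t - s)) =
      (fun y => h (t + y)) ∘ (-(ContinuousLinearMap.id ℝ (Rd d))) := by
    ext s; simp [sub_eq_add_neg]
  have h2 : ContDiff ℝ i (fun y => h (t + y)) := hh.comp (contDiff_const.add contDiff_id)
  rw [h1, ContinuousLinearMap.iteratedFDeriv_comp_right _ h2 _ le_rfl, iteratedFDeriv_comp_add_left]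
  ext v
  have := (iteratedFDeriv ℝ i h (t - s)).map_smul_univ (fun _ => (-1 : ℝ)) v
  simp only [Finset.prod_const, Finset.card_univ, Fintype.card_fin] at this
  simp only [ContinuousMultilinearMap.compContinuousLinearMap_apply, _root_.neg_apply,
    ContinuousLinearMap.id_apply, _root_.smul_apply, ← this, ← sub_eq_add_neg]
  congr 1
  ext1 j
  simp

namespace TestFn

variable {d : ℕ} {𝕜 : Type*} [RCLike 𝕜]

@[simp] theorem reflectAt_apply (φ : TestFn d 𝕜) (x t : Rd d) : φ.reflectAt x t = φ (x - t) := rfl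

@[simp] theorem dilate_apply (φ : TestFn d 𝕜) (j : ℕ) (t : Rd d) :
    φ.dilate j t = ((2 : ℝ) ^ (j * d)) • φ ((2 : ℝ) ^ j • t) := rfl

theorem reflectAt_add (φ ψ : TestFn d 𝕜) (x : Rd d) :
    (φ + ψ).reflectAt x = φ.reflectAt x + ψ.reflectAt x := rfl

theorem reflectAt_smul (c : 𝕜) (φ : TestFn d 𝕜) (x : Rd d) :
    (c • φ).reflectAt x = c • φ.reflectAt x := rfl

theorem iteratedFDeriv_reflectAt (φ : TestFn d 𝕜) (x t : Rd d) (i : ℕ) :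
    iteratedFDeriv ℝ i (φ.reflectAt x) t = (-1 : ℝ) ^ i • iteratedFDeriv ℝ i φ (x - t) :=
  iteratedFDeriv_comp_const_sub φ.contDiff_top x t

theorem tsupport_reflectAt_subset {φ : TestFn d 𝕜} {K : Set (Rd d)} (hK : IsCompact K)
    (hφ : tsupport φ ⊆ K) {x : Rd d} {X : Set (Rd d)} (hX : IsCompact X) (hx : x ∈ X) :
    tsupport (φ.reflectAt x) ⊆ X - K := by
  refine closure_minimal ?_ (isCompact_sub hX hK).isClosed
  intro t ht
  exact ⟨x, hx, x - t, hφ (subset_tsupport _ ht), by simp⟩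

/-- Each derivative of `φ` is continuous with compact support, hence uniformly continuous, so
translating it is continuous in the sup norm. -/
theorem continuous_jet_reflectAt (φ : TestFn d 𝕜) (N : ℕ) :
    Continuous fun x => jet N (φ.reflectAt x) := by
  refine continuous_pi (A := fun i : Fin (N + 1) => DerivSpace d 𝕜 i) fun i => ?_
  have hu : UniformContinuous (iteratedFDeriv ℝ i φ) :=
    (φ.hasCompactSupport.iteratedFDeriv i).uniformContinuous_of_continuous
      (φ.continuous_iteratedFDeriv i)
  refine (Metric.uniformContinuous_iff.2 fun ε hε => ?_ :
    UniformContinuous fun x => derivBCF (i : ℕ) (φ.reflectAt x)).continuous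
  obtain ⟨δ, hδ, h⟩ := Metric.uniformContinuous_iff.1 hu (ε / 2) (half_pos hε)
  refine ⟨δ, hδ, fun x y hxy => lt_of_le_of_lt ?_ (half_lt_self hε)⟩
  refine (BoundedContinuousFunction.dist_le (half_pos hε).le).2 fun t => ?_
  rw [derivBCF_apply, derivBCF_apply, iteratedFDeriv_reflectAt, iteratedFDeriv_reflectAt]
  have hd := (h (a := x - t) (b := y - t) (by simpa using hxy)).le
  rcases neg_one_pow_eq_or ℝ (i : ℕ) with h1 | h1 <;> rw [h1]
  · simpa only [one_smul] using hd
  · simpa only [neg_smul, one_smul, dist_neg_neg] using hd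

end TestFn

section Convolution

variable {d : ℕ} {𝕜 : Type*} [RCLike 𝕜]

theorem fnConv_apply (g h : Rd d → 𝕜) (x : Rd d) : fnConv g h x = ∫ t, g t * h (x - t) := rfl

theorem fnConv_eq_real (g h : Rd d → 𝕜) :
    fnConv g h = convolution g h (ContinuousLinearMap.mul ℝ 𝕜) volume := rfl

theorem fnConv_comm (g h : Rd d → 𝕜) : fnConv g h = fnConv h g := by
  rw [fnConv_eq_real, fnConv_eq_real, ← convolution_flip]
  congr 1
  ext a b
  exact mul_comm b a

theorem fnConv_apply_swap (g h : Rd d → 𝕜) (x : Rd d) : fnConv g h x = ∫ t, g (x - t) * h t := by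
  rw [fnConv_comm, fnConv_apply]
  simp_rw [mul_comm]

theorem continuous_fnConv {g h : Rd d → 𝕜} (hg : LocallyIntegrable g volume) (hh : Continuous h)
    (hhc : HasCompactSupport h) : Continuous (fnConv g h) :=
  hhc.continuous_convolution_right _ hg hh

theorem integrable_fnConv_integrand {g h : Rd d → 𝕜} (hg : LocallyIntegrable g volume)
    (hh : Continuous h) (hhc : HasCompactSupport h) (x : Rd d) :
    Integrable fun t => g t * h (x - t) :=
  hhc.convolutionExists_right (ContinuousLinearMap.mul ℝ 𝕜) hg hh x

end Convolution

namespace TestFn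

variable {d : ℕ} {𝕜 : Type*} [RCLike 𝕜]

theorem locallyIntegrable (φ : TestFn d 𝕜) : LocallyIntegrable φ volume :=
  φ.continuous.locallyIntegrable

/-- The convolution of two test functions. -/
noncomputable def conv (φ θ : TestFn d 𝕜) : TestFn d 𝕜 where
  toFun := fnConv φ θ
  contDiff' := θ.hasCompactSupport.contDiff_convolution_right (ContinuousLinearMap.mul ℝ 𝕜)
    φ.locallyIntegrable θ.contDiff
  hasCompactSupport' := φ.hasCompactSupport.convolution _ θ.hasCompactSupport
  tsupport_subset' := fun _ _ => trivial

theorem conv_coe (φ θ : TestFn d 𝕜) : ⇑(φ.conv θ) = fnConv φ θ := rfl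

theorem conv_comm (φ θ : TestFn d 𝕜) : φ.conv θ = θ.conv φ :=
  DFunLike.coe_injective (fnConv_comm φ θ)

theorem conv_assoc (φ ψ θ : TestFn d 𝕜) : (φ.conv ψ).conv θ = φ.conv (ψ.conv θ) := by
  ext x
  refine convolution_assoc (ContinuousLinearMap.mul ℝ 𝕜) (ContinuousLinearMap.mul ℝ 𝕜)
    (ContinuousLinearMap.mul ℝ 𝕜) (ContinuousLinearMap.mul ℝ 𝕜) (fun a b c => mul_assoc a b c)
    φ.continuous.aestronglyMeasurable ψ.continuous.aestronglyMeasurable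
    θ.continuous.aestronglyMeasurable ?_ ?_ ?_
  · exact Filter.Eventually.of_forall
      (ψ.hasCompactSupport.convolutionExists_right _ φ.locallyIntegrable ψ.continuous)
  · exact Filter.Eventually.of_forall
      (θ.hasCompactSupport.norm.convolutionExists_right _ ψ.continuous.norm.locallyIntegrable
        θ.continuous.norm)
  · have h1 : HasCompactSupport (convolution (fun x => ‖ψ x‖) (fun x => ‖θ x‖)
        (ContinuousLinearMap.mul ℝ ℝ) volume) :=
      ψ.hasCompactSupport.norm.convolution _ θ.hasCompactSupport.norm
    have h2 : Continuous (convolution (fun x => ‖ψ x‖) (fun x => ‖θ x‖)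
        (ContinuousLinearMap.mul ℝ ℝ) volume) :=
      θ.hasCompactSupport.norm.continuous_convolution_right _
        ψ.continuous.norm.locallyIntegrable θ.continuous.norm
    exact h1.convolutionExists_right _ φ.continuous.norm.locallyIntegrable h2 x

theorem conv_add (φ ψ θ : TestFn d 𝕜) : φ.conv (ψ + θ) = φ.conv ψ + φ.conv θ := by
  ext x
  exact ConvolutionExistsAt.distrib_add
    (ψ.hasCompactSupport.convolutionExists_right (ContinuousLinearMap.mul ℝ 𝕜)
      φ.locallyIntegrable ψ.continuous x)
    (θ.hasCompactSupport.convolutionExists_right (ContinuousLinearMap.mul ℝ 𝕜)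
      φ.locallyIntegrable θ.continuous x)

theorem conv_smul (c : 𝕜) (φ θ : TestFn d 𝕜) : φ.conv (c • θ) = c • φ.conv θ :=
  DFunLike.coe_injective (convolution_smul (L := ContinuousLinearMap.mul 𝕜 𝕜))

theorem conv_sub (φ ψ θ : TestFn d 𝕜) : φ.conv (ψ - θ) = φ.conv ψ - φ.conv θ := by
  have h : ψ - θ = ψ + (-1 : 𝕜) • θ := by simp [sub_eq_add_neg]
  rw [h, conv_add, conv_smul]
  simp [sub_eq_add_neg]

end TestFn

namespace Distr

variable {d : ℕ} {𝕜 : Type*} [RCLike 𝕜]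

theorem conv_apply (f : Distr d 𝕜) (φ : TestFn d 𝕜) (x : Rd d) :
    Distr.conv f φ x = f (φ.reflectAt x) := rfl

theorem conv_add (f : Distr d 𝕜) (φ ψ : TestFn d 𝕜) (x : Rd d) :
    Distr.conv f (φ + ψ) x = Distr.conv f φ x + Distr.conv f ψ x := by
  simp only [conv_apply, TestFn.reflectAt_add, map_add]

theorem conv_smul (f : Distr d 𝕜) (c : 𝕜) (φ : TestFn d 𝕜) (x : Rd d) :
    Distr.conv f (c • φ) x = c * Distr.conv f φ x := by
  simp only [conv_apply, TestFn.reflectAt_smul, map_smul, smul_eq_mul]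

theorem conv_sub (f : Distr d 𝕜) (φ ψ : TestFn d 𝕜) (x : Rd d) :
    Distr.conv f (φ - ψ) x = Distr.conv f φ x - Distr.conv f ψ x := by
  have h : φ - ψ = φ + (-1 : 𝕜) • ψ := by simp [sub_eq_add_neg]
  rw [h, conv_add, conv_smul]
  ring

theorem continuous_conv (f : Distr d 𝕜) (φ : TestFn d 𝕜) : Continuous (Distr.conv f φ) := by
  refine continuous_iff_continuousAt.2 fun x => ?_
  have hB := isCompact_closedBall x 1
  -- For `y` within distance 1 of `x` all the reflected supports lie in a single compact set, so one
  -- `F` represents `f` near `x`.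
  obtain ⟨N, F, hF⟩ := f.exists_jet_extension (isCompact_sub hB φ.hasCompactSupport)
  have hc : Continuous fun y => F (TestFn.jet N (φ.reflectAt y)) :=
    F.continuous.comp (φ.continuous_jet_reflectAt N)
  refine hc.continuousAt.congr ?_
  filter_upwards [Metric.closedBall_mem_nhds x one_pos] with y hy
  exact hF _ (TestFn.tsupport_reflectAt_subset φ.hasCompactSupport subset_rfl hB hy)

/-- For a distribution `f`, `f * (φ * θ) = (f * φ) * θ`. -/
theorem conv_conv (f : Distr d 𝕜) (φ θ : TestFn d 𝕜) :
    Distr.conv f (φ.conv θ) = fnConv (Distr.conv f φ) θ := by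
  funext x
  let T : Set (Rd d) := tsupport (θ.reflectAt x)
  have hT : IsCompact T := (θ.reflectAt x).hasCompactSupport
  let K : Set (Rd d) := (T - tsupport φ) ∪ tsupport ((φ.conv θ).reflectAt x)
  have hK : IsCompact K :=
    (isCompact_sub hT φ.hasCompactSupport).union ((φ.conv θ).reflectAt x).hasCompactSupport
  obtain ⟨N, F, hF⟩ := f.exists_jet_extension hK
  have hθ0 : ∀ t ∉ T, θ (x - t) = 0 := fun t ht =>
    image_eq_zero_of_notMem_tsupport (f := θ.reflectAt x) ht
  have hθc : Continuous fun t => θ (x - t) := θ.continuous.comp (continuous_const.sub continuous_id)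
  -- The Bochner integral of `H` is the jet of `φ * θ` reflected at `x`; applying `F` under the
  -- integral then gives the identity.
  let H : Rd d → JetSpace d 𝕜 N := fun t => θ (x - t) • TestFn.jet N (φ.reflectAt t)
  have hHc : Continuous H := hθc.smul (φ.continuous_jet_reflectAt N)
  have hHi : Integrable H := hHc.integrable_of_hasCompactSupport
    (HasCompactSupport.intro hT fun t ht => by simp [H, hθ0 t ht])
  have hint : ∫ t, H t = TestFn.jet N ((φ.conv θ).reflectAt x) := by
    have hG : ∀ s, (φ.conv θ).reflectAt x s = ∫ t, θ (x - t) * φ.reflectAt t s := by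
      intro s
      rw [TestFn.reflectAt_apply, TestFn.conv_coe, fnConv_apply,
        ← integral_sub_right_eq_self _ s]
      refine integral_congr_ae (Filter.Eventually.of_forall fun t => ?_)
      simp only [TestFn.reflectAt_apply, mul_comm]
      congr 2
      abel
    have hGf : ⇑((φ.conv θ).reflectAt x) = fun s => ∫ t, (θ (x - t) • φ.reflectAt t) s := funext hG
    funext i
    ext1 s
    have hev : (∫ t, H t) i s = ∫ t, H t i s := by
      let ev : JetSpace d 𝕜 N →L[ℝ] (Rd d [×(i : ℕ)]→L[ℝ] 𝕜) :=
        (BoundedContinuousFunction.evalCLM ℝ s).comp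
          (ContinuousLinearMap.proj (R := ℝ) (φ := fun i : Fin (N + 1) => DerivSpace d 𝕜 i) i)
      exact (ev.integral_comp_comm hHi).symm
    rw [hev, TestFn.jet_apply, hGf, iteratedFDeriv_integral_of_compact hT]
    · refine integral_congr_ae (Filter.Eventually.of_forall fun t => ?_)
      exact (iteratedFDeriv_const_smul_apply (φ.reflectAt t).contDiff_top.contDiffAt).symm
    · intro t ht s
      simp [hθ0 t ht]
    · exact fun i t => (θ (x - t) • φ.reflectAt t).contDiff_top
    · intro i
      have : ∀ p : Rd d × Rd d, iteratedFDeriv ℝ i (θ (x - p.1) • φ.reflectAt p.1) p.2 =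
          θ (x - p.1) • (-1 : ℝ) ^ i • iteratedFDeriv ℝ i φ (p.1 - p.2) := by
        intro p
        rw [← TestFn.iteratedFDeriv_reflectAt]
        exact iteratedFDeriv_const_smul_apply (φ.reflectAt p.1).contDiff_top.contDiffAt
      refine Continuous.congr ?_ fun p => (this p).symm
      have h2 : Continuous fun p : Rd d × Rd d => iteratedFDeriv ℝ i φ (p.1 - p.2) :=
        (φ.continuous_iteratedFDeriv i).comp (continuous_fst.sub continuous_snd)
      exact (hθc.comp continuous_fst).smul (h2.const_smul ((-1 : ℝ) ^ i))
  rw [conv_apply, ← hF _ Set.subset_union_right, ← hint, ← ContinuousLinearMap.integral_comp_comm _ hHi,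
    fnConv_apply]
  refine integral_congr_ae (Filter.Eventually.of_forall fun t => ?_)
  simp only [H, map_smul, smul_eq_mul]
  -- Off `T` the reflected support may leave `K`, where `F` need not represent `f`, but there the
  -- factor `θ (x - t)` vanishes.
  by_cases ht : t ∈ T
  · rw [hF _ ((TestFn.tsupport_reflectAt_subset φ.hasCompactSupport subset_rfl hT ht).trans
      Set.subset_union_left), mul_comm, conv_apply]
  · rw [hθ0 t ht, zero_mul, mul_zero]

end Distr

/-! ### Dilations and the Laplacian -/

theorem integral_dilate {d : ℕ} {V : Type*} [NormedAddCommGroup V] [NormedSpace ℝ V]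
    (g : Rd d → V) (j : ℕ) :
    ∫ t, ((2 : ℝ) ^ (j * d)) • g ((2 : ℝ) ^ j • t) = ∫ t, g t := by
  rw [integral_smul, Measure.integral_comp_smul, smul_smul, finrank_euclideanSpace,
    Fintype.card_fin, abs_of_pos (by positivity), ← pow_mul, mul_inv_cancel₀ (by positivity),
    one_smul]

namespace TestFn

variable {d : ℕ} {𝕜 : Type*} [RCLike 𝕜]

theorem dilate_conv (φ θ : TestFn d 𝕜) (j : ℕ) :
    (φ.conv θ).dilate j = (φ.dilate j).conv (θ.dilate j) := by
  ext x
  rw [dilate_apply, conv_coe, conv_coe, fnConv_apply, fnConv_apply, ← integral_dilate _ j,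
    ← integral_smul]
  refine integral_congr_ae (Filter.Eventually.of_forall fun t => ?_)
  simp only [dilate_apply, smul_sub, smul_mul_assoc, mul_smul_comm]

theorem dilate_add (φ θ : TestFn d 𝕜) (j : ℕ) :
    (φ + θ).dilate j = φ.dilate j + θ.dilate j := by
  ext x
  exact smul_add _ _ _

theorem tsupport_dilate_subset {φ : TestFn d 𝕜} {R : ℝ} (hφ : tsupport φ ⊆ Metric.closedBall 0 R)
    (j : ℕ) : tsupport (φ.dilate j) ⊆ Metric.closedBall 0 R := by
  refine closure_minimal (fun t ht => ?_) Metric.isClosed_closedBall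
  have h1 : (2 : ℝ) ^ j • t ∈ tsupport φ := by
    refine subset_tsupport _ fun h0 => ht ?_
    rw [dilate_apply, h0, smul_zero]
  have h2 := hφ h1
  rw [mem_closedBall_zero_iff, norm_smul, norm_pow, Real.norm_ofNat] at h2
  rw [mem_closedBall_zero_iff]
  exact (le_mul_of_one_le_left (norm_nonneg _) (one_le_pow₀ one_le_two)).trans h2

/-- The directional derivative of a test function. -/
noncomputable def pderiv (v : Rd d) (φ : TestFn d 𝕜) : TestFn d 𝕜 where
  toFun x := fderiv ℝ φ x v
  contDiff' := (φ.contDiff.fderiv_right (m := ((⊤ : ℕ∞) : WithTop ℕ∞)) (by exact le_rfl)).clm_apply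
    contDiff_const
  hasCompactSupport' := φ.hasCompactSupport.fderiv_apply ℝ v
  tsupport_subset' := fun _ _ => trivial

theorem pderiv_apply (v : Rd d) (φ : TestFn d 𝕜) (x : Rd d) : pderiv v φ x = fderiv ℝ φ x v := rfl

theorem differentiable (φ : TestFn d 𝕜) : Differentiable ℝ φ :=
  φ.contDiff.differentiable (by simp)

theorem pderiv_conv_right (v : Rd d) (φ θ : TestFn d 𝕜) :
    pderiv v (φ.conv θ) = φ.conv (pderiv v θ) := by
  ext x
  have h := θ.hasCompactSupport.hasFDerivAt_convolution_right (ContinuousLinearMap.mul ℝ 𝕜)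
    φ.locallyIntegrable (θ.contDiff_top (n := 1)) x
  have h' : HasFDerivAt (φ.conv θ) _ x := h
  rw [pderiv_apply, h'.fderiv]
  exact convolution_precompR_apply (ContinuousLinearMap.mul ℝ 𝕜) φ.locallyIntegrable
    (θ.hasCompactSupport.fderiv ℝ) (θ.contDiff.continuous_fderiv (by simp)) x v

theorem conv_pderiv (v : Rd d) (φ θ : TestFn d 𝕜) :
    φ.conv (pderiv v θ) = (pderiv v φ).conv θ := by
  rw [← pderiv_conv_right, conv_comm, pderiv_conv_right, conv_comm]

theorem pderiv_dilate (v : Rd d) (φ : TestFn d 𝕜) (j : ℕ) :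
    pderiv v (φ.dilate j) = ((2 : ℝ) ^ j) • (pderiv v φ).dilate j := by
  ext x
  have h1 : HasFDerivAt (fun t : Rd d => φ ((2 : ℝ) ^ j • t)) _ x :=
    (φ.differentiable ((2 : ℝ) ^ j • x)).hasFDerivAt.comp x
      ((hasFDerivAt_id (𝕜 := ℝ) x).const_smul ((2 : ℝ) ^ j))
  have h2 : HasFDerivAt (φ.dilate j) _ x := h1.const_smul ((2 : ℝ) ^ (j * d))
  rw [pderiv_apply, h2.fderiv]
  change (2 : ℝ) ^ (j * d) • fderiv ℝ φ ((2 : ℝ) ^ j • x) ((2 : ℝ) ^ j • v) =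
    (2 : ℝ) ^ j • (2 : ℝ) ^ (j * d) • fderiv ℝ φ ((2 : ℝ) ^ j • x) v
  rw [map_smul, smul_comm]

theorem pderiv_smul (v : Rd d) (c : ℝ) (φ : TestFn d 𝕜) : pderiv v (c • φ) = c • pderiv v φ := by
  ext x
  have : HasFDerivAt (c • φ : TestFn d 𝕜) (c • fderiv ℝ φ x) x :=
    (φ.differentiable x).hasFDerivAt.const_smul c
  rw [pderiv_apply, this.fderiv]
  rfl

/-- The Laplacian of a test function. -/
noncomputable def lap (φ : TestFn d 𝕜) : TestFn d 𝕜 :=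
  ∑ i : Fin d, pderiv (EuclideanSpace.basisFun (Fin d) ℝ i)
    (pderiv (EuclideanSpace.basisFun (Fin d) ℝ i) φ)

theorem sum_apply {κ : Type*} (s : Finset κ) (φ : κ → TestFn d 𝕜) (x : Rd d) :
    (∑ i ∈ s, φ i) x = ∑ i ∈ s, φ i x := by
  classical
  induction s using Finset.induction_on with
  | empty => rfl
  | insert i s hi ih => rw [Finset.sum_insert hi, Finset.sum_insert hi, ← ih]; rfl

theorem lap_apply (φ : TestFn d 𝕜) (x : Rd d) :
    φ.lap x = Laplacian.laplacian (φ : Rd d → 𝕜) x := by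
  rw [lap, sum_apply, InnerProductSpace.laplacian_eq_iteratedFDeriv_orthonormalBasis _
    (EuclideanSpace.basisFun (Fin d) ℝ)]
  refine Finset.sum_congr rfl fun i _ => ?_
  rw [iteratedFDeriv_two_apply, pderiv_apply]
  have h : DifferentiableAt ℝ (fderiv ℝ φ) x :=
    ((φ.contDiff.fderiv_right (m := ((⊤ : ℕ∞) : WithTop ℕ∞)) (by exact le_rfl)).differentiable
      (by simp)) x
  have h2 : HasFDerivAt (pderiv (EuclideanSpace.basisFun (Fin d) ℝ i) φ) _ x :=
    h.hasFDerivAt.clm_apply (hasFDerivAt_const (EuclideanSpace.basisFun (Fin d) ℝ i) x)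
  rw [h2.fderiv]
  simp

theorem conv_sum {κ : Type*} (s : Finset κ) (φ : TestFn d 𝕜) (ψ : κ → TestFn d 𝕜) :
    φ.conv (∑ i ∈ s, ψ i) = ∑ i ∈ s, φ.conv (ψ i) := by
  classical
  induction s using Finset.induction_on with
  | empty =>
    have := conv_smul (0 : 𝕜) φ 0
    simpa using this
  | insert i s hi ih => rw [Finset.sum_insert hi, Finset.sum_insert hi, conv_add, ih]

/-- Moves the Laplacian from the dilated factor `ψ_j` onto the fixed test function, so that the
factor `4^(-j)` of the refinement equation is kept. -/
theorem conv_lap (φ θ : TestFn d 𝕜) : φ.conv θ.lap = φ.lap.conv θ := by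
  rw [lap, lap, conv_sum, conv_comm _ θ, conv_sum]
  refine Finset.sum_congr rfl fun i _ => ?_
  rw [conv_pderiv, conv_pderiv, conv_comm]

theorem dilate_sum {κ : Type*} (s : Finset κ) (ψ : κ → TestFn d 𝕜) (j : ℕ) :
    (∑ i ∈ s, ψ i).dilate j = ∑ i ∈ s, (ψ i).dilate j := by
  ext x
  simp only [dilate_apply, sum_apply, Finset.smul_sum]

theorem lap_dilate (φ : TestFn d 𝕜) (j : ℕ) :
    (φ.dilate j).lap = ((4 : ℝ) ^ j) • φ.lap.dilate j := by
  rw [lap, lap, dilate_sum, Finset.smul_sum]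
  refine Finset.sum_congr rfl fun i _ => ?_
  rw [pderiv_dilate, pderiv_smul, pderiv_dilate, smul_smul, ← mul_pow]
  norm_num

end TestFn

/-! ### Approximate identity -/

/-- Dilates of a test function of integral one form an approximate identity. -/
theorem tendsto_fnConv_dilate {d : ℕ} {𝕜 : Type*} [RCLike 𝕜] {g : Rd d → 𝕜} (hg : Continuous g)
    {φ : TestFn d 𝕜} (hφ : ∫ x, φ x = 1) (x : Rd d) :
    Filter.Tendsto (fun j => fnConv g (φ.dilate j) x) Filter.atTop (nhds (g x)) := by
  have h1 : ∀ j : ℕ, fnConv g (φ.dilate j) x = ∫ t, g (x - ((2 : ℝ) ^ j)⁻¹ • t) * φ t := by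
    intro j
    rw [fnConv_apply_swap, ← integral_dilate (fun t => g (x - ((2 : ℝ) ^ j)⁻¹ • t) * φ t) j]
    refine integral_congr_ae (Filter.Eventually.of_forall fun t => ?_)
    simp only [TestFn.dilate_apply]
    rw [inv_smul_smul₀ (by positivity), mul_smul_comm]
  have h2 : g x = ∫ t, g x * φ t := by rw [integral_const_mul, hφ, mul_one]
  simp_rw [h1]
  rw [h2]
  obtain ⟨R, hR⟩ := (IsCompact.isBounded φ.hasCompactSupport).subset_closedBall 0
  obtain ⟨M, hM⟩ := (isCompact_closedBall x R).exists_bound_of_continuousOn hg.continuousOn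
  refine tendsto_integral_of_dominated_convergence (fun t => M * ‖φ t‖) ?_ ?_ ?_ ?_
  · intro j
    have h3 : Continuous fun t : Rd d => g (x - ((2 : ℝ) ^ j)⁻¹ • t) :=
      hg.comp (by fun_prop)
    exact (h3.mul φ.continuous).aestronglyMeasurable
  · exact (φ.continuous.integrable_of_hasCompactSupport φ.hasCompactSupport).norm.const_mul M
  · intro j
    refine Filter.Eventually.of_forall fun t => ?_
    rw [norm_mul]
    by_cases ht : φ t = 0
    · simp [ht]
    · have h3 := hR (subset_tsupport _ ht)
      rw [mem_closedBall_zero_iff] at h3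
      refine mul_le_mul_of_nonneg_right (hM _ ?_) (norm_nonneg _)
      rw [Metric.mem_closedBall, dist_eq_norm, sub_sub_cancel_left, norm_neg, norm_smul, norm_inv,
        norm_pow, Real.norm_ofNat]
      exact (mul_le_of_le_one_left (norm_nonneg _)
        (inv_le_one_of_one_le₀ (one_le_pow₀ one_le_two))).trans h3
  · refine Filter.Eventually.of_forall fun t => ?_
    refine Filter.Tendsto.mul_const _ ?_
    have h4 : Filter.Tendsto (fun j : ℕ => x - ((2 : ℝ) ^ j)⁻¹ • t) Filter.atTop
        (nhds (x - (0 : ℝ) • t)) := by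
      refine tendsto_const_nhds.sub (Filter.Tendsto.smul_const ?_ t)
      exact (tendsto_pow_atTop_atTop_of_one_lt one_lt_two).inv_tendsto_atTop
    rw [zero_smul, sub_zero] at h4
    exact (hg.tendsto x).comp h4

/-! ### Taylor expansion and vanishing moments -/

section Taylor

variable {d : ℕ} {𝕜 : Type*} [RCLike 𝕜]

/-- Expanding `t` in the standard basis makes `A(t, …, t)` a sum of monomials of degree `k`. The
exponent of `t i` counts the slots assigned to `i`. -/
theorem VanishingMoments.integral_multilinear {L : ℕ} {ψ : TestFn d 𝕜} (hψ : VanishingMoments L ψ)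
    {k : ℕ} (hk : k < L) (A : Rd d [×k]→L[ℝ] 𝕜) : ∫ t, ψ t * A (fun _ => t) = 0 := by
  have hA : ∀ t : Rd d, ψ t * A (fun _ => t) = ∑ r : Fin k → Fin d,
      ((∏ i, t i ^ (Finset.univ.filter fun s => r s = i).card) • ψ t) *
        A (fun s => EuclideanSpace.basisFun (Fin d) ℝ (r s)) := by
    intro t
    have ht : A (fun _ => t) =
        A (fun _ => ∑ i, t i • EuclideanSpace.basisFun (Fin d) ℝ i) := by
      congr 1
      ext1 s
      exact ((EuclideanSpace.basisFun (Fin d) ℝ).sum_repr t).symm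
    rw [ht, A.map_sum, Finset.mul_sum]
    refine Finset.sum_congr rfl fun r _ => ?_
    rw [A.map_smul_univ (fun s => t (r s)), ← Finset.prod_fiberwise' Finset.univ r (fun i => t i)]
    simp only [Finset.prod_const, mul_smul_comm, smul_mul_assoc]
  simp_rw [hA]
  rw [integral_finsetSum]
  · refine Finset.sum_eq_zero fun r _ => ?_
    rw [integral_mul_const, hψ, zero_mul]
    refine lt_of_eq_of_lt ?_ hk
    rw [← Finset.card_eq_sum_card_fiberwise (f := r) (s := Finset.univ) (t := Finset.univ)
      (fun _ _ => Finset.mem_coe.2 (Finset.mem_univ _))]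
    simp
  · intro r _
    refine Integrable.mul_const ?_ _
    refine Continuous.integrable_of_hasCompactSupport ?_ ?_
    · exact (continuous_finsetProd _ fun i _ => ((by fun_prop : Continuous fun t : Rd d =>
        t i).pow _)).smul ψ.continuous
    · exact HasCompactSupport.smul_left (f := fun t : Rd d => ∏ i, t i ^ (Finset.univ.filter
        fun s => r s = i).card) ψ.hasCompactSupport

theorem TestFn.iteratedDeriv_line (Θ : TestFn d 𝕜) (x v : Rd d) (k : ℕ) (s : ℝ) :
    iteratedDeriv k (fun s : ℝ => Θ (x + s • v)) s =
      iteratedFDeriv ℝ k Θ (x + s • v) (fun _ => v) := by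
  have h1 : (fun s : ℝ => Θ (x + s • v)) =
      (fun y => Θ (x + y)) ∘ (ContinuousLinearMap.toSpanSingleton ℝ v) := by
    ext s; simp
  have h2 : ContDiff ℝ k (fun y => Θ (x + y)) :=
    Θ.contDiff_top.comp (contDiff_const.add contDiff_id)
  rw [iteratedDeriv_eq_iteratedFDeriv, h1, ContinuousLinearMap.iteratedFDeriv_comp_right _ h2 _
    le_rfl, iteratedFDeriv_comp_add_left]
  simp

/-- Taylor's formula in one variable along the segment from `x` to `x + v`; the factorial in the
remainder is discarded. -/
theorem TestFn.taylor_bound (Θ : TestFn d 𝕜) (L : ℕ) : ∃ B, 0 ≤ B ∧ ∀ (x v : Rd d) (s : ℝ),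
    s ∈ Set.Icc (0 : ℝ) 1 →
    ‖Θ (x + s • v) - ∑ k ∈ Finset.range (L + 1), (((k.factorial : ℝ)⁻¹ * s ^ k) •
      iteratedFDeriv ℝ k Θ x (fun _ => v))‖ ≤ B * ‖v‖ ^ (L + 1) * s ^ (L + 1) := by
  obtain ⟨B, hB⟩ := Θ.exists_bound_iteratedFDeriv (L + 1)
  have hB0 : 0 ≤ B := (norm_nonneg _).trans (hB 0)
  refine ⟨B, hB0, fun x v s hs => ?_⟩
  have hp : ∀ n : ℕ, ContDiff ℝ n (fun s : ℝ => Θ (x + s • v)) := fun n =>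
    Θ.contDiff_top.comp (contDiff_const.add (contDiff_id.smul contDiff_const))
  have hu := uniqueDiffOn_Icc (zero_lt_one' ℝ)
  have hder : ∀ k, ∀ y ∈ Set.Icc (0 : ℝ) 1,
      iteratedDerivWithin k (fun s : ℝ => Θ (x + s • v)) (Set.Icc 0 1) y =
        iteratedFDeriv ℝ k Θ (x + y • v) (fun _ => v) := fun k y hy => by
    rw [iteratedDerivWithin_eq_iteratedDeriv hu (hp k).contDiffAt hy, Θ.iteratedDeriv_line]
  have h := taylor_mean_remainder_bound (f := fun s : ℝ => Θ (x + s • v)) (n := L)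
    (C := B * ‖v‖ ^ (L + 1)) zero_le_one (by exact_mod_cast (hp (L + 1)).contDiffOn) hs ?_
  · rw [taylor_within_apply] at h
    simp only [sub_zero] at h
    have heq : ∀ k, iteratedDerivWithin k (fun s : ℝ => Θ (x + s • v)) (Set.Icc 0 1) 0 =
        iteratedFDeriv ℝ k Θ x (fun _ => v) := fun k => by
      rw [hder k 0 (by simp)]; simp
    simp only [heq] at h
    refine h.trans (div_le_self (mul_nonneg (by positivity) (pow_nonneg hs.1 _)) ?_)
    exact_mod_cast L.factorial_pos
  · intro y hy
    rw [hder _ y hy]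
    refine (ContinuousMultilinearMap.le_opNorm _ _).trans ?_
    simp only [Finset.prod_const, Finset.card_univ, Fintype.card_fin]
    exact mul_le_mul_of_nonneg_right (hB _) (by positivity)

/-- Convolution with the dilates of a function with vanishing moments decays rapidly. -/
theorem VanishingMoments.exists_bound_dilate_conv {L : ℕ} {ψ : TestFn d 𝕜}
    (hψ : VanishingMoments (L + 1) ψ) (Θ : TestFn d 𝕜) :
    ∃ C, 0 ≤ C ∧ ∀ (j : ℕ) (x : Rd d),
      ‖(ψ.dilate j).conv Θ x‖ ≤ C * ((2 : ℝ) ^ (j * (L + 1)))⁻¹ := by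
  obtain ⟨B, hB0, hB⟩ := Θ.taylor_bound L
  have hint : Integrable fun t => ‖ψ t‖ * ‖t‖ ^ (L + 1) :=
    (ψ.continuous.norm.mul (continuous_norm.pow _)).integrable_of_hasCompactSupport
      ψ.hasCompactSupport.norm.mul_right
  refine ⟨B * ∫ t, ‖ψ t‖ * ‖t‖ ^ (L + 1), mul_nonneg hB0 (integral_nonneg fun t => by positivity),
    fun j x => ?_⟩
  set s : ℝ := ((2 : ℝ) ^ j)⁻¹ with hs_def
  have hs : s ∈ Set.Icc (0 : ℝ) 1 :=
    ⟨by positivity, inv_le_one_of_one_le₀ (one_le_pow₀ one_le_two)⟩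
  -- Rescaling moves the dilation onto `Θ`, which is now evaluated at distance `2^(-j) ‖t‖` from
  -- `x`. The moments of `ψ` annihilate the Taylor polynomial of degree `L`, leaving a remainder
  -- with the factor `s ^ (L + 1)`.
  have h1 : (ψ.dilate j).conv Θ x = ∫ t, ψ t * Θ (x + s • -t) := by
    rw [TestFn.conv_coe, fnConv_apply, ← integral_dilate (fun t => ψ t * Θ (x + s • -t)) j]
    refine integral_congr_ae (Filter.Eventually.of_forall fun t => ?_)
    simp only [TestFn.dilate_apply]
    rw [smul_neg, inv_smul_smul₀ (by positivity), smul_mul_assoc, sub_eq_add_neg]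
  have hvan : ∀ k ∈ Finset.range (L + 1), ∫ t, ψ t * (((k.factorial : ℝ)⁻¹ * s ^ k) •
      iteratedFDeriv ℝ k Θ x (fun _ => -t)) = 0 := by
    intro k hk
    have h2 := hψ.integral_multilinear (Finset.mem_range.1 hk) (iteratedFDeriv ℝ k Θ x)
    have h3 : ∀ t : Rd d, ψ t * (((k.factorial : ℝ)⁻¹ * s ^ k) •
        iteratedFDeriv ℝ k Θ x (fun _ => -t)) =
        ((k.factorial : ℝ)⁻¹ * s ^ k * (-1) ^ k) • (ψ t * iteratedFDeriv ℝ k Θ x (fun _ => t)) := by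
      intro t
      have := (iteratedFDeriv ℝ k Θ x).map_smul_univ (fun _ => (-1 : ℝ)) (fun _ => t)
      simp only [neg_smul, one_smul, Finset.prod_const, Finset.card_univ, Fintype.card_fin] at this
      rw [this, mul_smul_comm, mul_smul_comm, smul_smul]
    simp_rw [h3]
    rw [integral_smul, h2, smul_zero]
  have hcont : ∀ k : ℕ, Continuous fun t : Rd d => ψ t * (((k.factorial : ℝ)⁻¹ * s ^ k) •
      iteratedFDeriv ℝ k Θ x (fun _ => -t)) := fun k =>
    ψ.continuous.mul (((iteratedFDeriv ℝ k Θ x).cont.comp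
      (continuous_pi fun _ => continuous_neg)).const_smul _)
  have hint1 : Integrable fun t => ψ t * Θ (x + s • -t) :=
    (ψ.continuous.mul (Θ.continuous.comp (continuous_const.add
      (continuous_neg.const_smul s)))).integrable_of_hasCompactSupport
      ψ.hasCompactSupport.mul_right
  have hint2 : ∀ k ∈ Finset.range (L + 1), Integrable fun t =>
      ψ t * (((k.factorial : ℝ)⁻¹ * s ^ k) • iteratedFDeriv ℝ k Θ x (fun _ => -t)) := fun k _ =>
    (hcont k).integrable_of_hasCompactSupport ψ.hasCompactSupport.mul_right
  have h4 : (ψ.dilate j).conv Θ x = ∫ t, ψ t * (Θ (x + s • -t) -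
      ∑ k ∈ Finset.range (L + 1), (((k.factorial : ℝ)⁻¹ * s ^ k) •
        iteratedFDeriv ℝ k Θ x (fun _ => -t))) := by
    simp_rw [mul_sub, Finset.mul_sum]
    rw [integral_sub hint1 (integrable_finsetSum _ hint2), integral_finsetSum _ hint2,
      Finset.sum_eq_zero hvan, sub_zero, h1]
  have h5 : B * (∫ t, ‖ψ t‖ * ‖t‖ ^ (L + 1)) * ((2 : ℝ) ^ (j * (L + 1)))⁻¹ =
      ∫ t, (B * s ^ (L + 1)) * (‖ψ t‖ * ‖t‖ ^ (L + 1)) := by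
    rw [integral_const_mul, hs_def, inv_pow, ← pow_mul]
    ring
  rw [h4, h5]
  refine norm_integral_le_of_norm_le (hint.const_mul _)
    (Filter.Eventually.of_forall fun t => ?_)
  rw [norm_mul]
  refine (mul_le_mul_of_nonneg_left (hB x (-t) s hs) (norm_nonneg _)).trans_eq ?_
  rw [norm_neg]
  ring

end Taylor

/-! ### Weights, closed graph arguments and a Young inequality in `E` -/

theorem fnConv_congr_ae {d : ℕ} {𝕜 : Type*} [RCLike 𝕜] {g g' : Rd d → 𝕜} (h : Rd d → 𝕜)
    (hg : g =ᵐ[volume] g') : fnConv g h = fnConv g' h := by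
  funext x
  refine integral_congr_ae ?_
  filter_upwards [hg] with t ht
  rw [ht]

theorem IsWeightFunction.locallyIntegrable_smul {d : ℕ} {𝕜 : Type*} [RCLike 𝕜] {η : Rd d → ℝ}
    (hη : IsWeightFunction η) {u : Rd d → 𝕜} (hu : Continuous u) :
    LocallyIntegrable (fun x => η x • u x) volume := by
  refine locallyIntegrable_iff.2 fun K hK => ?_
  obtain ⟨C, hC⟩ := hη.locally_bounded K hK
  obtain ⟨M, hM⟩ := hK.exists_bound_of_continuousOn hu.continuousOn
  refine Measure.integrableOn_of_bounded (M := C * M) hK.measure_lt_top.ne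
    (hη.measurable.aestronglyMeasurable.smul hu.aestronglyMeasurable) ?_
  refine (ae_restrict_iff' hK.measurableSet).2 (Filter.Eventually.of_forall fun x hx => ?_)
  have h0 : 0 ≤ η x := zero_le_one.trans (hη.one_le x)
  rw [norm_smul, Real.norm_of_nonneg h0]
  exact mul_le_mul (hC x hx) (hM x hx) (norm_nonneg _) (h0.trans (hC x hx))

/-- Iterates (wM): a shift of length at most `N + 1` splits into parallel shifts of length at most
`N` and at most 1. -/
theorem WeakModerate.exists_le_of_norm_le {d : ℕ} {w : ℕ → Rd d → ℝ} (hw : WeakModerate w) (N : ℕ) :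
    ∀ n, ∃ m, ∃ C : ℝ, 0 < C ∧ ∀ x y : Rd d, ‖y‖ ≤ N → w n (x + y) ≤ C * w m x := by
  induction N with
  | zero =>
    intro n
    refine ⟨n, 1, one_pos, fun x y hy => ?_⟩
    have : y = 0 := by simpa using hy
    simp [this]
  | succ N ih =>
    intro n
    obtain ⟨m, -, C, hC, h⟩ := hw n
    obtain ⟨m', C', hC', h'⟩ := ih m
    refine ⟨m', C * C', mul_pos hC hC', fun x y hy => ?_⟩
    have hN : (0 : ℝ) < N + 1 := by positivity
    push_cast at hy
    have hy' : ‖y‖ / (N + 1) ≤ 1 := (div_le_one hN).2 hy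
    have h1 : ‖((N : ℝ) / (N + 1)) • y‖ ≤ N := by
      rw [norm_smul, Real.norm_of_nonneg (by positivity), div_mul_eq_mul_div, mul_div_assoc]
      exact mul_le_of_le_one_right (by positivity) hy'
    have h2 : ‖((1 : ℝ) / (N + 1)) • y‖ ≤ 1 := by
      rw [norm_smul, Real.norm_of_nonneg (by positivity), div_mul_eq_mul_div, one_mul]
      exact hy'
    have h3 : x + y = (x + ((N : ℝ) / (N + 1)) • y) + ((1 : ℝ) / (N + 1)) • y := by
      rw [add_assoc, ← add_smul, ← add_div, div_self hN.ne', one_smul]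
    rw [h3, mul_assoc]
    exact (h _ _ h2).trans (mul_le_mul_of_nonneg_left (h' _ _ h1) hC.le)

namespace IsSolidTIBF

variable {d : ℕ} {𝕜 : Type*} [RCLike 𝕜] {E : Type*} [NormedAddCommGroup E] [NormedSpace 𝕜 E]
  [CompleteSpace E] {ι : E →ₗ[𝕜] (Rd d →ₘ[volume] 𝕜)}

/-- Convergence in `E` implies `L¹` convergence on balls. Fatou's lemma then makes the liminf of `|ι
(e k - e₀)|` vanish almost everywhere, while its pointwise limit is `|h₀ - ι e₀|`. This gives the
closedness needed for closed graph arguments and identifies sums of series in `E`. -/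
theorem ae_eq_of_tendsto (hE : IsSolidTIBF ι) {e : ℕ → E} {e₀ : E}
    (he : Filter.Tendsto e Filter.atTop (nhds e₀)) {h : ℕ → Rd d → 𝕜} {h₀ : Rd d → 𝕜}
    (heh : ∀ k, ι (e k) =ᵐ[volume] h k)
    (hh : ∀ x, Filter.Tendsto (fun k => h k x) Filter.atTop (nhds (h₀ x))) :
    ι e₀ =ᵐ[volume] h₀ := by
  have hsub : ∀ᵐ x ∂(volume : Measure (Rd d)), ∀ k, ι (e k - e₀) x = h k x - ι e₀ x := by
    refine ae_all_iff.2 fun k => ?_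
    rw [map_sub]
    filter_upwards [AEEqFun.coeFn_sub (ι (e k)) (ι e₀), heh k] with x hx hx'
    rw [hx, Pi.sub_apply, hx']
  have key : ∀ n : ℕ, ∀ᵐ x ∂(volume : Measure (Rd d)), x ∈ Metric.closedBall (0 : Rd d) n →
      ι e₀ x = h₀ x := by
    intro n
    have hK := isCompact_closedBall (0 : Rd d) n
    obtain ⟨C, hC⟩ := hE.continuous_incl _ hK
    have hmeas : ∀ k, Measurable (fun x => ‖ι (e k - e₀) x‖ₑ) := fun k =>
      (AEEqFun.stronglyMeasurable _).enorm
    have hlim : Filter.Tendsto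
        (fun k => ∫⁻ x in Metric.closedBall (0 : Rd d) n, ‖ι (e k - e₀) x‖ₑ)
        Filter.atTop (nhds 0) := by
      have h1 : Filter.Tendsto (fun k => ENNReal.ofReal (C * ‖e k - e₀‖)) Filter.atTop (nhds 0) := by
        have h2 : Filter.Tendsto (fun k => C * ‖e k - e₀‖) Filter.atTop (nhds (C * 0)) :=
          (tendsto_iff_norm_sub_tendsto_zero.1 he).const_mul C
        rw [mul_zero] at h2
        simpa [Function.comp_def] using (ENNReal.continuous_ofReal.tendsto 0).comp h2
      refine tendsto_of_tendsto_of_tendsto_of_le_of_le tendsto_const_nhds h1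
        (fun _ => bot_le) fun k => ?_
      simp only
      rw [← ofReal_integral_norm_eq_lintegral_enorm
        ((hE.locallyIntegrable _).integrableOn_isCompact hK)]
      exact ENNReal.ofReal_le_ofReal (hC _)
    have hfatou := lintegral_liminf_le' (u := Filter.atTop)
      (μ := volume.restrict (Metric.closedBall (0 : Rd d) n)) fun k => (hmeas k).aemeasurable
    rw [hlim.liminf_eq] at hfatou
    have h0 := (lintegral_eq_zero_iff' (Measurable.liminf hmeas).aemeasurable).1 (le_antisymm hfatou bot_le)
    have h1 := (ae_restrict_iff' hK.measurableSet).1 h0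
    filter_upwards [h1, hsub] with x hx hx' hxK
    have h2 := hx hxK
    have h3 : Filter.Tendsto (fun k => ‖ι (e k - e₀) x‖ₑ) Filter.atTop
        (nhds ‖h₀ x - ι e₀ x‖ₑ) := by
      simp_rw [hx']
      exact (continuous_enorm.tendsto _).comp ((hh x).sub_const _)
    rw [h3.liminf_eq] at h2
    exact (sub_eq_zero.1 (enorm_eq_zero.1 h2)).symm
  filter_upwards [ae_all_iff.2 key] with x hx
  obtain ⟨n, hn⟩ := exists_nat_ge ‖x‖
  exact hx n (mem_closedBall_zero_iff.2 hn)

/-- A linear map into `E` given pointwise by continuous functionals is bounded. -/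
theorem exists_bound_of_pointwise (hE : IsSolidTIBF ι) {X : Type*} [NormedAddCommGroup X]
    [NormedSpace 𝕜 X] [CompleteSpace X] (ℓ : Rd d → X →L[𝕜] 𝕜)
    (hℓ : ∀ a, ∃ e : E, ι e =ᵐ[volume] fun x => ℓ x a) :
    ∃ C, 0 ≤ C ∧ ∀ (a : X) (e : E), (ι e =ᵐ[volume] fun x => ℓ x a) → ‖e‖ ≤ C * ‖a‖ := by
  choose T hT using hℓ
  have huniq : ∀ (e e' : E) (u : Rd d → 𝕜), ι e =ᵐ[volume] u → ι e' =ᵐ[volume] u → e = e' :=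
    fun e e' u h h' => hE.injective (AEEqFun.ext (h.trans h'.symm))
  let TL : X →ₗ[𝕜] E :=
    { toFun := T
      map_add' := fun a b => by
        refine huniq _ _ _ (hT (a + b)) ?_
        rw [map_add]
        filter_upwards [AEEqFun.coeFn_add (ι (T a)) (ι (T b)), hT a, hT b] with x h1 h2 h3
        rw [h1, Pi.add_apply, h2, h3, map_add]
      map_smul' := fun c a => by
        refine huniq _ _ _ (hT (c • a)) ?_
        rw [RingHom.id_apply, map_smul]
        filter_upwards [AEEqFun.coeFn_smul c (ι (T a)), hT a] with x h1 h2
        rw [h1, Pi.smul_apply, h2, map_smul] }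
  -- Closed graph theorem: if `u k → a` and `T (u k) → e`, the pointwise limits `ℓ x (u k) → ℓ x a`
  -- force `e = T a`.
  have hcont : Continuous TL := by
    refine TL.continuous_of_seq_closed_graph fun u a e hu hTu => ?_
    refine huniq _ _ _ (hE.ae_eq_of_tendsto hTu (h := fun k x => ℓ x (u k))
      (h₀ := fun x => ℓ x a) (fun k => hT (u k)) fun x => ?_) (hT a)
    exact ((ℓ x).continuous.tendsto a).comp hu
  let TC : X →L[𝕜] E := ⟨TL, hcont⟩
  refine ⟨‖TC‖, norm_nonneg _, fun a e he => ?_⟩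
  rw [huniq e (T a) _ he (hT a)]
  exact TC.le_opNorm a

/-- The axiom `E * C_c ⊆ E` carries no norm estimate; the closed graph theorem supplies it. The
evaluations `e ↦ (e * κ)(x)` are continuous because `E` embeds continuously in `L¹_loc`. -/
theorem exists_bound_fnConv (hE : IsSolidTIBF ι) {κ : Rd d → 𝕜} (hκ : Continuous κ)
    (hκc : HasCompactSupport κ) :
    ∃ C, 0 ≤ C ∧ ∀ e e' : E, ι e' =ᵐ[volume] fnConv (ι e) κ → ‖e'‖ ≤ C * ‖e‖ := by
  have hbd : ∀ x : Rd d, ∃ C, ∀ e : E, ‖fnConv (ι e) κ x‖ ≤ C * ‖e‖ := by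
    intro x
    obtain ⟨M, hM⟩ := hκ.bounded_above_of_compact_support hκc
    let S : Set (Rd d) := {x} - tsupport κ
    have hS : IsCompact S := isCompact_sub isCompact_singleton hκc
    obtain ⟨C, hC⟩ := hE.continuous_incl S hS
    have hM0 : 0 ≤ M := (norm_nonneg _).trans (hM 0)
    refine ⟨M * C, fun e => ?_⟩
    have hmem : ∀ t ∉ S, κ (x - t) = 0 := by
      intro t ht
      by_contra h0
      exact ht ⟨x, rfl, x - t, subset_tsupport _ h0, by simp⟩
    rw [fnConv_apply, ← setIntegral_eq_integral_of_forall_compl_eq_zero (s := S)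
      (fun t ht => by rw [hmem t ht, mul_zero])]
    refine (norm_integral_le_of_norm_le (g := fun t => M * ‖ι e t‖)
      (((hE.locallyIntegrable e).integrableOn_isCompact hS).norm.const_mul M)
      (Filter.Eventually.of_forall fun t => ?_)).trans ?_
    · rw [norm_mul, mul_comm]
      exact mul_le_mul_of_nonneg_right (hM _) (norm_nonneg _)
    · rw [integral_const_mul, mul_assoc]
      exact mul_le_mul_of_nonneg_left (hC e) hM0
  choose C hC using hbd
  let ℓ : Rd d → E →L[𝕜] 𝕜 := fun x => LinearMap.mkContinuous
    { toFun := fun e => fnConv (ι e) κ x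
      map_add' := fun a b => by
        rw [map_add, fnConv_congr_ae κ (AEEqFun.coeFn_add (ι a) (ι b))]
        simp only [fnConv_apply, Pi.add_apply, add_mul]
        exact integral_add (integrable_fnConv_integrand (hE.locallyIntegrable a) hκ hκc x)
          (integrable_fnConv_integrand (hE.locallyIntegrable b) hκ hκc x)
      map_smul' := fun c a => by
        rw [map_smul, fnConv_congr_ae κ (AEEqFun.coeFn_smul c (ι a))]
        simp only [fnConv_apply, Pi.smul_apply, smul_eq_mul, mul_assoc, RingHom.id_apply]
        exact integral_const_mul c _ } (C x) (hC x)
  exact hE.exists_bound_of_pointwise ℓ fun a => hE.convolution_mem a κ hκ hκc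

/-- Weighted Young-type inequality in `E`. -/
theorem exists_weighted_bound (hE : IsSolidTIBF ι) {w : ℕ → Rd d → ℝ} (hw : IsWeightSystem w)
    (hwM : WeakModerate w) (n : ℕ) (R : ℝ) :
    ∃ (m : ℕ) (C : ℝ), 0 ≤ C ∧ ∀ (g : Rd d → 𝕜) (e : E) (η : TestFn d 𝕜) (M : ℝ), Continuous g →
      (ι e =ᵐ[volume] fun x => w m x • g x) → tsupport η ⊆ Metric.closedBall 0 R →
      (∀ x, ‖η x‖ ≤ M) →
      ∃ e' : E, (ι e' =ᵐ[volume] fun x => w n x • fnConv g η x) ∧ ‖e'‖ ≤ C * M * ‖e‖ := by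
  obtain ⟨N, hN⟩ := exists_nat_ge R
  obtain ⟨m, C, hC, hwC⟩ := hwM.exists_le_of_norm_le N n
  -- A fixed kernel that is at least 1 on the ball of radius `R`. Comparison with it makes the final
  -- constant depend on `η` only through `R` and `M`.
  let κ₀ : Rd d → ℝ := fun x => max 0 (R + 1 - ‖x‖)
  have hκ₀ : Continuous κ₀ := by fun_prop
  have hκ₀c : HasCompactSupport κ₀ := by
    refine HasCompactSupport.intro (isCompact_closedBall (0 : Rd d) (R + 1)) fun x hx => ?_
    rw [mem_closedBall_zero_iff, not_le] at hx
    exact max_eq_left (by linarith)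
  let κ : Rd d → 𝕜 := fun x => (κ₀ x : 𝕜)
  have hκ : Continuous κ := RCLike.continuous_ofReal.comp hκ₀
  have hκc : HasCompactSupport κ := hκ₀c.comp_left (g := fun r : ℝ => (r : 𝕜)) (by simp)
  obtain ⟨B, hB, hBb⟩ := hE.exists_bound_fnConv hκ hκc
  refine ⟨m, C * B, mul_nonneg hC.le hB, fun g e η M hg he hη hM => ?_⟩
  have hM0 : 0 ≤ M := (norm_nonneg _).trans (hM 0)
  let H : Rd d → 𝕜 := fun x => ((‖ι e x‖ : ℝ) : 𝕜)
  have hHn : ∀ x, ‖H x‖ = ‖ι e x‖ := fun x => by simp [H]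
  have hHloc : LocallyIntegrable H volume :=
    (hE.locallyIntegrable e).mono (RCLike.continuous_ofReal.comp_aestronglyMeasurable
      (AEEqFun.aestronglyMeasurable _).norm) (Filter.Eventually.of_forall fun x => (hHn x).le)
  obtain ⟨eH, heH, heHn⟩ := hE.solid e H hHloc (Filter.Eventually.of_forall fun x => (hHn x).le)
  obtain ⟨e₁, he₁⟩ := hE.convolution_mem eH κ hκ hκc
  have he₁n := (hBb _ _ he₁).trans (mul_le_mul_of_nonneg_left heHn hB)
  rw [fnConv_congr_ae κ heH] at he₁
  -- On the support of `η (x - ·)` one has `w n x ≤ C * w m t`, so the weight passes inside the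
  -- integral and `C M (|ι e| * κ)` dominates. Solidity then puts the left side in `E`.
  have hbound : ∀ x, ‖w n x • fnConv g η x‖ ≤ ‖((C * M : ℝ) : 𝕜) * fnConv H κ x‖ := by
    intro x
    have hint : Integrable fun t => ‖ι e t‖ * κ₀ (x - t) :=
      integrable_fnConv_integrand (𝕜 := ℝ) ((hE.locallyIntegrable e).mono
        (AEEqFun.aestronglyMeasurable _).norm (Filter.Eventually.of_forall fun t => by simp))
        hκ₀ hκ₀c x
    have h1 : fnConv H κ x = ((∫ t, ‖ι e t‖ * κ₀ (x - t) : ℝ) : 𝕜) := by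
      rw [fnConv_apply, ← integral_ofReal]
      simp [H, κ]
    have h2 : 0 ≤ ∫ t, ‖ι e t‖ * κ₀ (x - t) :=
      integral_nonneg fun t => mul_nonneg (norm_nonneg _) (le_max_left _ _)
    rw [h1, ← RCLike.ofReal_mul, RCLike.norm_ofReal, abs_of_nonneg (by positivity),
      fnConv_apply, ← integral_smul, ← integral_const_mul]
    refine norm_integral_le_of_norm_le (hint.const_mul _) ?_
    filter_upwards [he] with t ht
    have hwn : 0 ≤ w n x := zero_le_one.trans ((hw.weight n).one_le x)
    have hwm : 0 ≤ w m t := zero_le_one.trans ((hw.weight m).one_le t)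
    rw [ht, norm_smul, norm_mul, norm_smul, Real.norm_of_nonneg hwn, Real.norm_of_nonneg hwm]
    by_cases h0 : η (x - t) = 0
    · rw [h0, norm_zero, mul_zero, mul_zero]
      exact mul_nonneg (by positivity) (mul_nonneg (by positivity) (le_max_left _ _))
    · have hxt : ‖x - t‖ ≤ R := mem_closedBall_zero_iff.1 (hη (subset_tsupport _ h0))
      have h3 : w n x ≤ C * w m t := by
        simpa using hwC t (x - t) (hxt.trans hN)
      have h4 : 1 ≤ κ₀ (x - t) := le_max_of_le_right (by linarith)
      calc w n x * (‖g t‖ * ‖η (x - t)‖) ≤ (C * w m t) * (‖g t‖ * M) := by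
            gcongr
            exact hM _
        _ = C * M * (w m t * ‖g t‖ * 1) := by ring
        _ ≤ C * M * (w m t * ‖g t‖ * κ₀ (x - t)) := by gcongr
  have hloc : LocallyIntegrable (fun x => w n x • fnConv g η x) volume :=
    (hw.weight n).locallyIntegrable_smul
      (continuous_fnConv hg.locallyIntegrable η.continuous η.hasCompactSupport)
  obtain ⟨e', he', hn'⟩ := hE.solid (((C * M : ℝ) : 𝕜) • e₁) _ hloc (by
    rw [map_smul]
    filter_upwards [AEEqFun.coeFn_smul (((C * M : ℝ) : 𝕜)) (ι e₁), he₁] with x h1 h2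
    rw [h1, Pi.smul_apply, h2, smul_eq_mul]
    exact hbound x)
  refine ⟨e', he', hn'.trans ?_⟩
  rw [norm_smul, RCLike.norm_ofReal, abs_of_nonneg (by positivity)]
  calc C * M * ‖e₁‖ ≤ C * M * (B * ‖e‖) := by gcongr
    _ = C * B * M * ‖e‖ := by ring

end IsSolidTIBF

/-! ### Derivatives of dilates and `ℓ¹` combinations of bounded sequences of test functions -/

namespace TestFn

variable {d : ℕ} {𝕜 : Type*} [RCLike 𝕜]

theorem real_smul_eq (c : ℝ) (φ : TestFn d 𝕜) : c • φ = (c : 𝕜) • φ := by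
  ext x
  exact RCLike.real_smul_eq_coe_smul (K := 𝕜) c (φ x)

/-- In the exponent, `d` comes from the normalization and `i` from the chain rule. -/
theorem norm_iteratedFDeriv_dilate_le {φ : TestFn d 𝕜} {i : ℕ} {B : ℝ}
    (hB : ∀ x, ‖iteratedFDeriv ℝ i φ x‖ ≤ B) (j : ℕ) (x : Rd d) :
    ‖iteratedFDeriv ℝ i (φ.dilate j) x‖ ≤ (2 : ℝ) ^ (j * (d + i)) * B := by
  have hB0 : 0 ≤ B := (norm_nonneg _).trans (hB 0)
  let S : Rd d →L[ℝ] Rd d := ((2 : ℝ) ^ j) • ContinuousLinearMap.id ℝ (Rd d)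
  have hS : ‖S‖ ≤ (2 : ℝ) ^ j := by
    refine (norm_smul_le ((2 : ℝ) ^ j) (ContinuousLinearMap.id ℝ (Rd d))).trans ?_
    rw [norm_pow, Real.norm_ofNat]
    exact mul_le_of_le_one_right (by positivity) ContinuousLinearMap.norm_id_le
  have h1 : (φ.dilate j : Rd d → 𝕜) = ((2 : ℝ) ^ (j * d)) • (φ ∘ S) := rfl
  have h2 : ContDiff ℝ i (φ ∘ S) := φ.contDiff_top.comp S.contDiff
  rw [h1, iteratedFDeriv_const_smul_apply h2.contDiffAt,
    ContinuousLinearMap.iteratedFDeriv_comp_right S φ.contDiff_top x le_rfl, mul_add, pow_add,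
    mul_assoc]
  refine (norm_smul_le _ _).trans ?_
  rw [norm_pow, Real.norm_ofNat]
  refine mul_le_mul_of_nonneg_left ?_ (by positivity)
  refine (ContinuousMultilinearMap.norm_compContinuousLinearMap_le _ _).trans ?_
  simp only [Finset.prod_const, Finset.card_univ, Fintype.card_fin]
  rw [mul_comm, pow_mul]
  exact mul_le_mul (pow_le_pow_left₀ (norm_nonneg _) hS i) (hB _) (norm_nonneg _) (by positivity)

theorem tsupport_smul_subset (c : 𝕜) (φ : TestFn d 𝕜) : tsupport (c • φ) ⊆ tsupport φ :=
  tsupport_smul_subset_right (fun _ => c) φ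

theorem norm_iteratedFDeriv_smul (c : 𝕜) (φ : TestFn d 𝕜) (i : ℕ) (x : Rd d) :
    ‖iteratedFDeriv ℝ i (c • φ : TestFn d 𝕜) x‖ = ‖c‖ * ‖iteratedFDeriv ℝ i φ x‖ := by
  have : iteratedFDeriv ℝ i (c • φ : TestFn d 𝕜) x = c • iteratedFDeriv ℝ i φ x :=
    iteratedFDeriv_const_smul_apply φ.contDiff_top.contDiffAt
  rw [this, norm_smul]

section Series

variable {b : ℕ → TestFn d 𝕜} {K : Set (Rd d)} {M : ℕ → ℝ}

theorem summable_norm_of_lp_one (a : lp (fun _ : ℕ => 𝕜) 1) : Summable fun r => ‖a r‖ := by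
  simpa using (lp.memℓp a).summable (by simp)

theorem norm_lp_one (a : lp (fun _ : ℕ => 𝕜) 1) : ‖a‖ = ∑' r, ‖a r‖ := by
  simpa using lp.norm_eq_tsum_rpow (p := 1) (by simp) a

/-- The sum of a series of test functions, with coefficients in `ℓ¹`. -/
noncomputable def series (hK : IsCompact K) (hb : ∀ r, tsupport (b r) ⊆ K)
    (hM : ∀ i r x, ‖iteratedFDeriv ℝ i (b r) x‖ ≤ M i) (a : lp (fun _ : ℕ => 𝕜) 1) :
    TestFn d 𝕜 where
  toFun x := ∑' r, (a r • b r) x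
  contDiff' := contDiff_tsum (v := fun i r => ‖a r‖ * M i) (fun r => (a r • b r).contDiff)
    (fun i _ => (summable_norm_of_lp_one a).mul_right (M i)) fun i r x _ => by
      rw [norm_iteratedFDeriv_smul]
      exact mul_le_mul_of_nonneg_left (hM i r x) (norm_nonneg _)
  hasCompactSupport' := HasCompactSupport.intro hK fun x hx => by
    have : ∀ r, (a r • b r) x = 0 := fun r => by
      have h0 : b r x = 0 := image_eq_zero_of_notMem_tsupport fun h => hx (hb r h)
      change a r • b r x = 0
      rw [h0, smul_zero]
    simp [this]
  tsupport_subset' := fun _ _ => trivial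

variable (hK : IsCompact K) (hb : ∀ r, tsupport (b r) ⊆ K)
  (hM : ∀ i r x, ‖iteratedFDeriv ℝ i (b r) x‖ ≤ M i)

theorem series_apply (a : lp (fun _ : ℕ => 𝕜) 1) (x : Rd d) :
    series hK hb hM a x = ∑' r, a r * b r x := rfl

theorem summable_series (hM : ∀ i r x, ‖iteratedFDeriv ℝ i (b r) x‖ ≤ M i)
    (a : lp (fun _ : ℕ => 𝕜) 1) (x : Rd d) : Summable fun r => a r * b r x := by
  refine Summable.of_norm_bounded ((summable_norm_of_lp_one a).mul_right (M 0)) fun r => ?_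
  rw [norm_mul]
  refine mul_le_mul_of_nonneg_left ?_ (norm_nonneg _)
  simpa using hM 0 r x

theorem series_add (a a' : lp (fun _ : ℕ => 𝕜) 1) :
    series hK hb hM (a + a') = series hK hb hM a + series hK hb hM a' := by
  ext x
  change series hK hb hM (a + a') x = series hK hb hM a x + series hK hb hM a' x
  simp only [series_apply]
  rw [← (summable_series hM a x).tsum_add (summable_series hM a' x)]
  simp [add_mul]

theorem series_smul (c : 𝕜) (a : lp (fun _ : ℕ => 𝕜) 1) :
    series hK hb hM (c • a) = c • series hK hb hM a := by
  ext x
  change series hK hb hM (c • a) x = c * series hK hb hM a x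
  simp only [series_apply]
  rw [← tsum_mul_left]
  simp [mul_assoc]

theorem series_single (r : ℕ) : series hK hb hM (lp.single 1 r (1 : 𝕜)) = b r := by
  ext x
  rw [series_apply, tsum_eq_single r]
  · simp
  · intro r' hr'
    rw [lp.single_apply_ne _ _ _ hr', zero_mul]

theorem tsupport_series_subset (a : lp (fun _ : ℕ => 𝕜) 1) :
    tsupport (series hK hb hM a) ⊆ K := by
  refine closure_minimal (fun x hx => ?_) hK.isClosed
  by_contra hxK
  refine hx ?_
  have : ∀ r, a r * b r x = 0 := fun r => by
    rw [image_eq_zero_of_notMem_tsupport fun h => hxK (hb r h), mul_zero]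
  rw [series_apply]
  simp [this]

theorem norm_iteratedFDeriv_series_le (a : lp (fun _ : ℕ => 𝕜) 1) (i : ℕ) (x : Rd d) :
    ‖iteratedFDeriv ℝ i (series hK hb hM a) x‖ ≤ M i * ‖a‖ := by
  have hbd : ∀ (i r : ℕ) (x : Rd d), ‖iteratedFDeriv ℝ i (a r • b r : TestFn d 𝕜) x‖ ≤
      ‖a r‖ * M i := fun i r x => by
    rw [norm_iteratedFDeriv_smul]
    exact mul_le_mul_of_nonneg_left (hM i r x) (norm_nonneg _)
  have hs : ∀ i : ℕ, Summable fun r => ‖a r‖ * M i := fun i =>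
    (summable_norm_of_lp_one a).mul_right (M i)
  have h1 : iteratedFDeriv ℝ i (series hK hb hM a) x =
      ∑' r, iteratedFDeriv ℝ i (a r • b r : TestFn d 𝕜) x :=
    iteratedFDeriv_tsum_apply (N := ⊤) (v := fun i r => ‖a r‖ * M i)
      (fun r => (a r • b r).contDiff) (fun i _ => hs i) (fun i r x _ => hbd i r x)
      (by exact_mod_cast le_top) x
  rw [h1, norm_lp_one, mul_comm, ← tsum_mul_right]
  exact tsum_of_norm_bounded (hs i).hasSum fun r => hbd i r x

end Series

end TestFn

/-! ### From convolutors to polynomial growth -/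

section BoundedSequences

variable {d : ℕ} {𝕜 : Type*} [RCLike 𝕜] {E : Type*} [NormedAddCommGroup E] [NormedSpace 𝕜 E]
  [CompleteSpace E] {ι : E →ₗ[𝕜] (Rd d →ₘ[volume] 𝕜)}

/-- Convolution with a convolutor maps bounded sequences of test functions to bounded sequences. -/
theorem IsSolidTIBF.exists_bound_conv_of_bounded (hE : IsSolidTIBF ι) {w : ℕ → Rd d → ℝ}
    {f : Distr d 𝕜} (hf : f ∈ convolutorSpace ι w) (n : ℕ) {b : ℕ → TestFn d 𝕜} {K : Set (Rd d)}
    {M : ℕ → ℝ} (hK : IsCompact K) (hb : ∀ r, tsupport (b r) ⊆ K)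
    (hM : ∀ i r x, ‖iteratedFDeriv ℝ i (b r) x‖ ≤ M i) :
    ∃ C : ℝ, ∀ (r : ℕ) (e : E), (ι e =ᵐ[volume] fun x => w n x • Distr.conv f (b r) x) →
      ‖e‖ ≤ C := by
  -- At a fixed `x` only finitely many derivatives matter, and each is controlled by `M i * ‖a‖`; so
  -- evaluation at `x` is a continuous functional on `ℓ¹`.
  have hbd : ∀ x, ∃ C, ∀ a : lp (fun _ : ℕ => 𝕜) 1,
      ‖w n x • Distr.conv f (TestFn.series hK hb hM a) x‖ ≤ C * ‖a‖ := by
    intro x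
    obtain ⟨N, C, hC, h⟩ := Distr.exists_bound f (isCompact_sub (isCompact_singleton (x := x)) hK)
    have hM0 : ∀ i, 0 ≤ M i := fun i => (norm_nonneg _).trans (hM i 0 0)
    refine ⟨‖w n x‖ * (C * ∑ i ∈ Finset.range (N + 1), M i), fun a => ?_⟩
    rw [norm_smul, mul_assoc, mul_assoc, Finset.sum_mul]
    refine mul_le_mul_of_nonneg_left (h _ _ (TestFn.tsupport_reflectAt_subset hK
      (TestFn.tsupport_series_subset hK hb hM a) isCompact_singleton rfl) fun i hi t => ?_)
      (norm_nonneg _)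
    rw [TestFn.iteratedFDeriv_reflectAt]
    refine (norm_smul_le _ _).trans ?_
    rw [norm_pow, norm_neg, norm_one, one_pow, one_mul]
    refine (TestFn.norm_iteratedFDeriv_series_le hK hb hM a i _).trans ?_
    exact Finset.single_le_sum (f := fun i => M i * ‖a‖)
      (fun i _ => mul_nonneg (hM0 i) (norm_nonneg _)) (Finset.mem_range.2 (Nat.lt_succ_of_le hi))
  choose C hC using hbd
  let ℓ : Rd d → lp (fun _ : ℕ => 𝕜) 1 →L[𝕜] 𝕜 := fun x => LinearMap.mkContinuous
    { toFun := fun a => w n x • Distr.conv f (TestFn.series hK hb hM a) x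
      map_add' := fun a a' => by
        rw [TestFn.series_add, Distr.conv_add, smul_add]
      map_smul' := fun c a => by
        rw [TestFn.series_smul, Distr.conv_smul, RingHom.id_apply, smul_eq_mul,
          mul_smul_comm] } (C x) (hC x)
  obtain ⟨B, hB, h⟩ := hE.exists_bound_of_pointwise ℓ fun a =>
    (Set.mem_iInter.1 (hf (TestFn.series hK hb hM a)) n).2
  refine ⟨B, fun r e he => ?_⟩
  -- The unit vectors of `ℓ¹` have norm 1 and are sent to the individual `b r`.
  have h1 := h (lp.single 1 r (1 : 𝕜)) e (by
    have : ∀ x, ℓ x (lp.single 1 r (1 : 𝕜)) = w n x • Distr.conv f (b r) x := fun x => by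
      change w n x • Distr.conv f (TestFn.series hK hb hM (lp.single 1 r (1 : 𝕜))) x = _
      rw [TestFn.series_single]
    simpa only [this] using he)
  simpa [lp.norm_single] using h1

theorem IsSolidTIBF.exists_polynomial_bound (hE : IsSolidTIBF ι) {w : ℕ → Rd d → ℝ}
    {f : Distr d 𝕜} (hf : f ∈ convolutorSpace ι w) (φ : TestFn d 𝕜) (n : ℕ) :
    ∃ r : ℝ, 0 < r ∧ IsBoundedSetIn ι
      {g | ∃ j : ℕ, g = fun x =>
        ((2 : ℝ) ^ (-(r * (j : ℝ))) * w n x) • Distr.conv f (φ.dilate j) x} := by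
  have hex : ∀ j : ℕ, ∃ e : E, ι e =ᵐ[volume] fun x => w n x • Distr.conv f (φ.dilate j) x :=
    fun j => (Set.mem_iInter.1 (hf (φ.dilate j)) n).2
  choose e he using hex
  -- The same `r` serves as exponent and as bound, so negation yields one sequence violating both.
  -- The shift `r + 1` keeps the exponent positive.
  have key : ∃ r : ℕ, ∀ j : ℕ, ((2 : ℝ) ^ ((r + 1) * j))⁻¹ * ‖e j‖ ≤ r := by
    by_contra hcon
    push Not at hcon
    choose J hJ using hcon
    obtain ⟨R, hR⟩ := (IsCompact.isBounded φ.hasCompactSupport).subset_closedBall 0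
    choose B hB using fun i => φ.exists_bound_iteratedFDeriv i
    let c : ℕ → 𝕜 := fun r => ((((2 : ℝ) ^ ((r + 1) * J r))⁻¹ : ℝ) : 𝕜)
    have hc : ∀ r, ‖c r‖ = ((2 : ℝ) ^ ((r + 1) * J r))⁻¹ := fun r => by
      rw [RCLike.norm_ofReal, abs_of_pos (by positivity)]
    let b : ℕ → TestFn d 𝕜 := fun r => c r • φ.dilate (J r)
    have hb : ∀ r, tsupport (b r) ⊆ Metric.closedBall 0 R := fun r =>
      (TestFn.tsupport_smul_subset _ _).trans (TestFn.tsupport_dilate_subset hR _)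
    -- For `r ≥ d + i` the factor `2^(-(r+1) J r)` absorbs the derivative cost `2^(J r (d+i))`; the
    -- finitely many smaller `r` are covered by the sum.
    have hM : ∀ i r x, ‖iteratedFDeriv ℝ i (b r) x‖ ≤
        (1 + ∑ r' ∈ Finset.range (d + i), (2 : ℝ) ^ (J r' * (d + i))) * B i := by
      intro i r x
      have hB0 : 0 ≤ B i := (norm_nonneg _).trans (hB i 0)
      rw [TestFn.norm_iteratedFDeriv_smul, hc]
      refine (mul_le_mul_of_nonneg_left
        (TestFn.norm_iteratedFDeriv_dilate_le (hB i) (J r) x) (by positivity)).trans ?_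
      rw [← mul_assoc]
      refine mul_le_mul_of_nonneg_right ?_ hB0
      have hsum : 0 ≤ ∑ r' ∈ Finset.range (d + i), (2 : ℝ) ^ (J r' * (d + i)) :=
        Finset.sum_nonneg fun _ _ => by positivity
      by_cases hr : r < d + i
      · have h1 : (2 : ℝ) ^ (J r * (d + i)) ≤
            ∑ r' ∈ Finset.range (d + i), (2 : ℝ) ^ (J r' * (d + i)) :=
          Finset.single_le_sum (f := fun r' => (2 : ℝ) ^ (J r' * (d + i)))
            (fun _ _ => by positivity) (Finset.mem_range.2 hr)
        have h2 : ((2 : ℝ) ^ ((r + 1) * J r))⁻¹ * (2 : ℝ) ^ (J r * (d + i)) ≤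
            (2 : ℝ) ^ (J r * (d + i)) :=
          mul_le_of_le_one_left (by positivity)
            (inv_le_one_of_one_le₀ (one_le_pow₀ one_le_two))
        linarith
      · have h1 : ((2 : ℝ) ^ ((r + 1) * J r))⁻¹ * (2 : ℝ) ^ (J r * (d + i)) ≤ 1 := by
          rw [inv_mul_le_one₀ (by positivity)]
          refine pow_le_pow_right₀ one_le_two ?_
          rw [mul_comm (r + 1)]
          exact Nat.mul_le_mul_left _ (by omega)
        linarith
    obtain ⟨C, hC⟩ := hE.exists_bound_conv_of_bounded hf n
      (isCompact_closedBall (0 : Rd d) R) hb hM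
    obtain ⟨r, hr⟩ := exists_nat_ge C
    have h1 := hC r (c r • e (J r)) (by
      rw [map_smul]
      filter_upwards [AEEqFun.coeFn_smul (c r) (ι (e (J r))), he (J r)] with x h1 h2
      rw [h1, Pi.smul_apply, h2, Distr.conv_smul, smul_eq_mul, mul_smul_comm])
    rw [norm_smul, hc] at h1
    exact absurd (h1.trans hr) (not_le.2 (hJ r))
  obtain ⟨r, hr⟩ := key
  refine ⟨(r : ℝ) + 1, by positivity, r, ?_⟩
  rintro g ⟨j, rfl⟩
  have hpow : (2 : ℝ) ^ (-(((r : ℝ) + 1) * (j : ℝ))) = ((2 : ℝ) ^ ((r + 1) * j))⁻¹ := by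
    rw [Real.rpow_neg zero_le_two, ← Real.rpow_natCast]
    push_cast
    rfl
  refine ⟨((((2 : ℝ) ^ ((r + 1) * j))⁻¹ : ℝ) : 𝕜) • e j, ?_, ?_⟩
  · rw [map_smul, hpow]
    filter_upwards [AEEqFun.coeFn_smul ((((2 : ℝ) ^ ((r + 1) * j))⁻¹ : ℝ) : 𝕜) (ι (e j)), he j]
      with x h1 h2
    rw [h1, Pi.smul_apply, h2, mul_smul, ← RCLike.real_smul_eq_coe_smul]
  · rw [norm_smul, RCLike.norm_ofReal, abs_of_pos (by positivity)]
    exact hr j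

end BoundedSequences

/-! ### Reconstruction from the windows -/

namespace TestFn

variable {d : ℕ} {𝕜 : Type*} [RCLike 𝕜]

theorem tsupport_conv_subset {φ θ : TestFn d 𝕜} {R S : ℝ}
    (hφ : tsupport φ ⊆ Metric.closedBall 0 R) (hθ : tsupport θ ⊆ Metric.closedBall 0 S) :
    tsupport (φ.conv θ) ⊆ Metric.closedBall 0 (R + S) := by
  refine closure_minimal (fun x hx => ?_) Metric.isClosed_closedBall
  by_contra hxR
  refine hx ?_
  rw [conv_coe, fnConv_apply]
  refine integral_eq_zero_of_ae (Filter.Eventually.of_forall fun t => ?_)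
  by_contra h0
  have h1 := hφ (subset_tsupport _ (left_ne_zero_of_mul h0))
  have h2 := hθ (subset_tsupport _ (right_ne_zero_of_mul h0))
  rw [mem_closedBall_zero_iff] at h1 h2 hxR
  have h3 := norm_add_le t (x - t)
  rw [add_sub_cancel] at h3
  exact hxR (h3.trans (add_le_add h1 h2))

/-- The dyadic refinement equation, at every scale. -/
theorem dilate_succ_sub {φ ψ : TestFn d 𝕜} (h : ∀ x : Rd d, ((2 : ℝ) ^ d) • φ ((2 : ℝ) • x) - φ x =
    Laplacian.laplacian (ψ : Rd d → 𝕜) x) (j : ℕ) :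
    φ.dilate (j + 1) - φ.dilate j = ((((4 : ℝ) ^ j)⁻¹ : ℝ) : 𝕜) • (ψ.dilate j).lap := by
  rw [lap_dilate, ← real_smul_eq, inv_smul_smul₀ (by positivity)]
  ext x
  change φ.dilate (j + 1) x - φ.dilate j x = _
  rw [dilate_apply, dilate_apply, dilate_apply, lap_apply, ← h, smul_sub, smul_smul, smul_smul,
    pow_succ' 2 j, ← pow_add, add_mul, one_mul]

end TestFn

section Reconstruction

variable {d : ℕ} {𝕜 : Type*} [RCLike 𝕜] {E : Type*} [NormedAddCommGroup E] [NormedSpace 𝕜 E]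
  {ι : E →ₗ[𝕜] (Rd d →ₘ[volume] 𝕜)}

theorem coeFn_map_smul_of_ae_eq {e : E} {g : Rd d → 𝕜} (he : ι e =ᵐ[volume] g) (c : 𝕜) :
    ι (c • e) =ᵐ[volume] fun x => c * g x := by
  rw [map_smul]
  filter_upwards [AEEqFun.coeFn_smul c (ι e), he] with x h1 h2
  rw [h1, Pi.smul_apply, h2, smul_eq_mul]

theorem coeFn_map_add_of_ae_eq {e e' : E} {g g' : Rd d → 𝕜} (he : ι e =ᵐ[volume] g)
    (he' : ι e' =ᵐ[volume] g') : ι (e + e') =ᵐ[volume] fun x => g x + g' x := by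
  rw [map_add]
  filter_upwards [AEEqFun.coeFn_add (ι e) (ι e'), he, he'] with x h1 h2 h3
  rw [h1, Pi.add_apply, h2, h3]

theorem exists_rescale {η : Rd d → ℝ} {g : Rd d → 𝕜} {c B : ℝ} (hc : 0 < c) {e : E}
    (he : ι e =ᵐ[volume] fun x => (c * η x) • g x) (hB : ‖e‖ ≤ B) {c' : ℝ} (hc' : 0 < c') :
    ∃ e' : E, (ι e' =ᵐ[volume] fun x => (c' * η x) • g x) ∧ ‖e'‖ ≤ c' / c * B := by
  refine ⟨((c' / c : ℝ) : 𝕜) • e, ?_, ?_⟩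
  · filter_upwards [coeFn_map_smul_of_ae_eq he ((c' / c : ℝ) : 𝕜)] with x hx
    rw [hx, ← smul_eq_mul, ← RCLike.real_smul_eq_coe_smul, smul_smul]
    congr 1
    field_simp
  · rw [norm_smul, RCLike.norm_ofReal, abs_of_pos (by positivity)]
    gcongr

/-- A telescoping series with summable norms in `E` converges to its pointwise limit. -/
theorem IsSolidTIBF.exists_of_telescoping [CompleteSpace E] (hE : IsSolidTIBF ι)
    {u : ℕ → Rd d → 𝕜} {u' : Rd d → 𝕜}
    (hu : ∀ x, Filter.Tendsto (fun j => u j x) Filter.atTop (nhds (u' x))) {e₀ : E}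
    (he₀ : ι e₀ =ᵐ[volume] u 0) {e : ℕ → E}
    (he : ∀ j, ι (e j) =ᵐ[volume] fun x => u (j + 1) x - u j x)
    (hs : Summable fun j => ‖e j‖) : ∃ e' : E, ι e' =ᵐ[volume] u' := by
  have hpart : ∀ k, ι (e₀ + ∑ j ∈ Finset.range k, e j) =ᵐ[volume] u k := by
    intro k
    induction k with
    | zero => simpa using he₀
    | succ k ih =>
      rw [Finset.sum_range_succ, ← add_assoc]
      filter_upwards [coeFn_map_add_of_ae_eq ih (he k)] with x hx
      rw [hx]
      ring
  exact ⟨_, hE.ae_eq_of_tendsto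
    (tendsto_const_nhds.add hs.of_norm.hasSum.tendsto_sum_nat) hpart hu⟩

variable [CompleteSpace E]

/-- Polynomial bounds for the windows of a pair with the MDFP imply the convolutor property. -/
theorem IsSolidTIBF.mem_convolutorSpace_of_bounded (hE : IsSolidTIBF ι) {w : ℕ → Rd d → ℝ}
    (hw : IsWeightSystem w) (hwM : WeakModerate w) {χ : Fin 2 → TestFn d 𝕜} (hχ : MDFP χ)
    {f : Distr d 𝕜}
    (hf : ∀ n : ℕ, ∃ r : ℝ, 0 < r ∧ IsBoundedSetIn ι
      {g | ∃ (j : ℕ) (l : Fin 2), g = fun x =>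
        ((2 : ℝ) ^ (-(r * (j : ℝ))) * w n x) • Distr.conv f ((χ l).dilate j) x}) :
    f ∈ convolutorSpace ι w := by
  intro θ
  refine Set.mem_iInter.2 fun n => ⟨(Distr.continuous_conv f θ).locallyIntegrable, ?_⟩
  obtain ⟨K, hK, -, hKL⟩ := hχ
  obtain ⟨R₀, hR₀⟩ := hK.isBounded.subset_closedBall 0
  -- One radius for both `θ`, used in the initial term, and `Δθ`, used in the increments.
  obtain ⟨R₁, hR₁⟩ := ((IsCompact.isBounded θ.hasCompactSupport).union
    (IsCompact.isBounded θ.lap.hasCompactSupport)).subset_closedBall 0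
  obtain ⟨m, C, hC, hYoung⟩ := hE.exists_weighted_bound hw hwM n (R₀ + R₁)
  obtain ⟨r, hr, B, hB⟩ := hf m
  have hB0 : 0 ≤ B := by
    obtain ⟨e, -, he⟩ := hB _ ⟨0, 0, rfl⟩
    exact (norm_nonneg e).trans he
  have hwin : ∀ (j : ℕ) (l : Fin 2), ∃ e : E,
      (ι e =ᵐ[volume] fun x => w m x • Distr.conv f ((χ l).dilate j) x) ∧
        ‖e‖ ≤ (2 : ℝ) ^ (r * (j : ℝ)) * B := by
    intro j l
    obtain ⟨e, he, hen⟩ := hB _ ⟨j, l, rfl⟩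
    obtain ⟨e', he', hen'⟩ := exists_rescale (by positivity) he hen one_pos
    refine ⟨e', by simpa using he', hen'.trans_eq ?_⟩
    rw [Real.rpow_neg zero_le_two, one_div, inv_inv]
  -- With moments vanishing up to order `⌈r⌉₊`, the decay `2^(-j(⌈r⌉₊+1))` beats the window growth
  -- `2^(rj)`.
  obtain ⟨φ, ψ, hsupp, href, hint, hφ, hψ⟩ := hKL (⌈r⌉₊ + 1)
  set L := ⌈r⌉₊
  have hφ' : φ 0 = (χ 0).conv (φ 0) + (χ 1).conv (φ 1) := by
    ext x
    exact hφ x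
  have hψ' : ψ 0 = (χ 0).conv (ψ 0) + (χ 1).conv (ψ 1) := by
    ext x
    exact hψ x
  -- Common estimate for a factorized `η 0`, applied once to `φ` with `Θ = θ` at `j = 0`, and to `ψ`
  -- with `Θ = Δθ` at every `j`. Dilates shrink supports, so the Young constant `C` does not depend
  -- on `j`.
  have hpair : ∀ (j : ℕ) (η : Fin 2 → TestFn d 𝕜) (Θ : TestFn d 𝕜) (M : ℝ),
      (∀ l, tsupport (η l) ⊆ K) → tsupport Θ ⊆ Metric.closedBall 0 R₁ →
      (∀ l x, ‖((η l).dilate j).conv Θ x‖ ≤ M) →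
      η 0 = (χ 0).conv (η 0) + (χ 1).conv (η 1) →
      ∃ e : E, (ι e =ᵐ[volume] fun x => w n x • Distr.conv f (Θ.conv ((η 0).dilate j)) x) ∧
        ‖e‖ ≤ 2 * (C * M * ((2 : ℝ) ^ (r * (j : ℝ)) * B)) := by
    intro j η Θ M hη hΘ hM hdec
    have hM0 : 0 ≤ M := (norm_nonneg _).trans (hM 0 0)
    have hterm : ∀ l, ∃ e : E, (ι e =ᵐ[volume] fun x =>
        w n x • Distr.conv f (((χ l).dilate j).conv (((η l).dilate j).conv Θ)) x) ∧
        ‖e‖ ≤ C * M * ((2 : ℝ) ^ (r * (j : ℝ)) * B) := by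
      intro l
      obtain ⟨e, he, hen⟩ := hwin j l
      obtain ⟨e', he', hen'⟩ := hYoung _ e (((η l).dilate j).conv Θ) M
        (Distr.continuous_conv f _) he (TestFn.tsupport_conv_subset
          (TestFn.tsupport_dilate_subset ((hη l).trans hR₀) j) hΘ) (hM l)
      refine ⟨e', by simpa only [Distr.conv_conv f ((χ l).dilate j)] using he', hen'.trans ?_⟩
      gcongr
    obtain ⟨a, ha, han⟩ := hterm 0
    obtain ⟨b, hb, hbn⟩ := hterm 1
    refine ⟨a + b, ?_, (norm_add_le a b).trans (by linarith)⟩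
    have heq : Θ.conv ((η 0).dilate j) = ((χ 0).dilate j).conv (((η 0).dilate j).conv Θ) +
        ((χ 1).dilate j).conv (((η 1).dilate j).conv Θ) := by
      conv_lhs => rw [hdec, TestFn.dilate_add, TestFn.dilate_conv, TestFn.dilate_conv,
        TestFn.conv_add, TestFn.conv_comm, TestFn.conv_comm Θ, TestFn.conv_assoc,
        TestFn.conv_assoc]
    filter_upwards [coeFn_map_add_of_ae_eq ha hb] with x hx
    rw [hx, heq, Distr.conv_add, smul_add]
  let u : ℕ → Rd d → 𝕜 := fun j x => w n x • Distr.conv f (θ.conv ((φ 0).dilate j)) x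
  have hlim : ∀ x, Filter.Tendsto (fun j => u j x) Filter.atTop
      (nhds (w n x • Distr.conv f θ x)) := by
    intro x
    simp only [u, Distr.conv_conv f θ]
    exact (tendsto_fnConv_dilate (Distr.continuous_conv f θ) hint x).const_smul (w n x)
  choose M₀ hM₀ using fun l => (((φ l).dilate 0).conv θ).exists_bound_iteratedFDeriv 0
  obtain ⟨e₀, he₀, -⟩ := hpair 0 φ θ (max (M₀ 0) (M₀ 1)) (fun l => (hsupp l).1)
    (Set.subset_union_left.trans hR₁) (fun l x => by
      have h1 : ‖((φ l).dilate 0).conv θ x‖ ≤ M₀ l := by simpa using hM₀ l x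
      refine h1.trans ?_
      fin_cases l
      · exact le_max_left _ _
      · exact le_max_right _ _) hφ'
  choose M₁ hM₁0 hM₁ using fun l => (hsupp l).2.2.1.exists_bound_dilate_conv θ.lap
  -- Moment decay cancels the window growth, and the `4^(-j)` of the refinement equation remains as
  -- a summable factor.
  have hstep : ∀ j : ℕ, ∃ e : E, (ι e =ᵐ[volume] fun x => u (j + 1) x - u j x) ∧
      ‖e‖ ≤ 2 * (C * (M₁ 0 + M₁ 1) * B) * ((4 : ℝ)⁻¹) ^ j := by
    intro j
    obtain ⟨e, he, hen⟩ := hpair j ψ θ.lap ((M₁ 0 + M₁ 1) * ((2 : ℝ) ^ (j * (L + 1)))⁻¹)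
      (fun l => (hsupp l).2.1) (Set.subset_union_right.trans hR₁) (fun l x => by
        refine (hM₁ l j x).trans ?_
        gcongr
        fin_cases l
        · exact le_add_of_nonneg_right (hM₁0 1)
        · exact le_add_of_nonneg_left (hM₁0 0)) hψ'
    refine ⟨((((4 : ℝ) ^ j)⁻¹ : ℝ) : 𝕜) • e, ?_, ?_⟩
    · filter_upwards [coeFn_map_smul_of_ae_eq he ((((4 : ℝ) ^ j)⁻¹ : ℝ) : 𝕜)] with x hx
      rw [hx, ← smul_sub, ← Distr.conv_sub, ← TestFn.conv_sub, TestFn.dilate_succ_sub href,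
        TestFn.conv_smul, Distr.conv_smul, TestFn.conv_lap, mul_smul_comm]
    · rw [norm_smul, RCLike.norm_ofReal, abs_of_pos (by positivity), inv_pow, mul_comm]
      gcongr
      refine hen.trans ?_
      have hpow : (2 : ℝ) ^ (r * (j : ℝ)) ≤ (2 : ℝ) ^ (j * (L + 1)) := by
        rw [← Real.rpow_natCast]
        refine Real.rpow_le_rpow_of_exponent_le one_le_two ?_
        push_cast
        rw [mul_comm r]
        gcongr
        linarith [Nat.le_ceil r]
      have hle : ((2 : ℝ) ^ (j * (L + 1)))⁻¹ * (2 : ℝ) ^ (r * (j : ℝ)) ≤ 1 := by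
        rwa [inv_mul_le_one₀ (by positivity)]
      have hnn : 0 ≤ 2 * (C * (M₁ 0 + M₁ 1) * B) := by
        have := hM₁0 0
        have := hM₁0 1
        positivity
      calc 2 * (C * ((M₁ 0 + M₁ 1) * ((2 : ℝ) ^ (j * (L + 1)))⁻¹) *
            ((2 : ℝ) ^ (r * (j : ℝ)) * B)) = 2 * (C * (M₁ 0 + M₁ 1) * B) *
            (((2 : ℝ) ^ (j * (L + 1)))⁻¹ * (2 : ℝ) ^ (r * (j : ℝ))) := by ring
        _ ≤ 2 * (C * (M₁ 0 + M₁ 1) * B) := mul_le_of_le_one_right hnn hle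
  choose e he hen using hstep
  refine hE.exists_of_telescoping hlim he₀ he ?_
  exact Summable.of_nonneg_of_le (fun j => norm_nonneg _) hen
    ((summable_geometric_of_lt_one (by norm_num) (by norm_num)).mul_left _)

end Reconstruction

/-! ### The equivalence -/

theorem theoremt {d : ℕ} {𝕜 : Type*} [RCLike 𝕜]
    {E : Type*} [NormedAddCommGroup E] [NormedSpace 𝕜 E] [CompleteSpace E]
    (ι : E →ₗ[𝕜] (Rd d →ₘ[volume] 𝕜)) (hE : IsSolidTIBF ι)
    (w : ℕ → Rd d → ℝ) (hw : IsWeightSystem w) (hwM : WeakModerate w)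
    (χ : Fin 2 → TestFn d 𝕜) (hχ : MDFP χ) (f : Distr d 𝕜) :
    List.TFAE
      [f ∈ convolutorSpace ι w,
       ∀ (φ : TestFn d 𝕜) (n : ℕ), ∃ r : ℝ, 0 < r ∧
         IsBoundedSetIn ι
           {g | ∃ j : ℕ, g = fun x =>
             ((2 : ℝ) ^ (-(r * (j : ℝ))) * w n x) • f.conv (φ.dilate j) x},
       ∀ n : ℕ, ∃ r : ℝ, 0 < r ∧
         IsBoundedSetIn ι
           {g | ∃ (j : ℕ) (l : Fin 2), g = fun x =>
             ((2 : ℝ) ^ (-(r * (j : ℝ))) * w n x) • f.conv ((χ l).dilate j) x}] := by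
  tfae_have 1 → 2 := fun hf φ n => hE.exists_polynomial_bound hf φ n
  tfae_have 2 → 3 := by
    intro h n
    choose r hr B hB using fun l => h (χ l) n
    refine ⟨max (r 0) (r 1), lt_max_of_lt_left (hr 0), max (B 0) (B 1), ?_⟩
    rintro g ⟨j, l, rfl⟩
    have hle : ∀ l, r l ≤ max (r 0) (r 1) ∧ B l ≤ max (B 0) (B 1) := fun l => by
      fin_cases l <;> simp
    obtain ⟨e, he, hen⟩ := hB l _ ⟨j, rfl⟩
    -- Passing to the larger exponent multiplies by `2^((r l - max) j) ≤ 1`, so the bound survives.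
    obtain ⟨e', he', hen'⟩ := exists_rescale (by positivity) he (hen.trans (hle l).2)
      (c' := (2 : ℝ) ^ (-(max (r 0) (r 1) * (j : ℝ)))) (by positivity)
    have hB0 : 0 ≤ max (B 0) (B 1) := (norm_nonneg e).trans (hen.trans (hle l).2)
    refine ⟨e', he', hen'.trans (mul_le_of_le_one_left hB0 ?_)⟩
    rw [div_le_one (by positivity)]
    refine Real.rpow_le_rpow_of_exponent_le one_le_two (neg_le_neg ?_)
    exact mul_le_mul_of_nonneg_right (hle l).1 (Nat.cast_nonneg j)
  tfae_have 3 → 1 := hE.mem_convolutorSpace_of_bounded hw hwM hχ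
  tfae_finish
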